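/- Let $d$ be a positive integer with $3\nmid d$, let $K_0=\mathbf Q(\sqrt{3d})$, and let $\varepsilon_0$ be a fundamental unit of $K_0$. Let $\mathbf B_1=\mathbf Q(\zeta_9+\zeta_9^{-1})$ be the first level of the $\mathbf Z_3$-extension of $\mathbf Q$, and put $K_1=K_0\mathbf B_1$. Let $g$ generate $\mathrm{Gal}(K_1/\mathbf B_1)$ (of order $2$) and let $\tau$ generate $\mathrm{Gal}(K_1/K_0)$ (of order $3$). Let $E$ be the unit group of the ring of integers of $K_1$, regard $E/E^3$ as an $\mathbf F_3$-vector space on which $g$ and $\tau$ act, let $M=(E/E^3)^{1-g}$ be the image of $1-g$, and let $M[1-\tau]$ be the kernel of $1-\tau$ on $M$. Then exactly one of the following cases holds. Case (i): (a) $\dim_{\mathbf F_3} M[1-\tau]=1$; (b) the map from the class group of $K_0$ to the class group of $K_1$ given by extension of ideals is injective; (c) the norm map from the units of $K_1$ to the units of $K_0$ is surjective; (d) there are units $\varepsilon_1,\varepsilon_2$ of $K_1$ such that the classes of $\varepsilon_0,\varepsilon_1,\varepsilon_2$ lie in $M$ and form a basis of $M$, and such that $\varepsilon_2^{1-\tau}=\varepsilon_1$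 and $\varepsilon_2^{1+\tau+\tau^2}=\varepsilon_0$ in $E$. Case (ii): (a) $\dim_{\mathbf F_3} M[1-\tau]=2$; (b) the kernel of the map from the class group of $K_0$ to the class group of $K_1$ given by extension of ideals has order $3$; (c) the cokernel of the norm map from the units of $K_1$ to the units of $K_0$ has order $3$; (d) there are units $\varepsilon_1,\varepsilon_2$ of $K_1$ such that the classes of $\varepsilon_0,\varepsilon_1,\varepsilon_2$ lie in $M$ and form a basis of $M$, and such that $\varepsilon_2^{1-\tau}=\varepsilon_1$ and $\varepsilon_2^{1+\tau+\tau^2}=1$ in $E$. -/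

import Mathlib

open NumberField

noncomputable section

namespace KummerUnits

/-- The real quadratic field `ℚ(√(3d))`, as a subfield of `ℝ`. -/
def quadField (d : ℕ) : IntermediateField ℚ ℝ :=
  IntermediateField.adjoin ℚ {√(3 * (d : ℝ))}

/-- The first level of the (cyclotomic) `ℤ₃`-extension of `ℚ`: the cubic subfield
`ℚ(ζ₉ + ζ₉⁻¹)` of `ℚ(ζ₉)`, where `ζ₉ + ζ₉⁻¹ = 2 cos (2π/9)`. -/
def cubicField : IntermediateField ℚ ℝ :=
  IntermediateField.adjoin ℚ {2 * Real.cos (2 * Real.pi / 9)}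

/-- The compositum `K₁` of `ℚ(√(3d))` and the first level of the `ℤ₃`-extension of `ℚ`. -/
def K₁ (d : ℕ) : IntermediateField ℚ ℝ := quadField d ⊔ cubicField

/-- `K₀ = ℚ(√(3d))`, as a subfield of `K₁`. -/
def K₀ (d : ℕ) : IntermediateField ℚ (K₁ d) :=
  IntermediateField.restrict (le_sup_left : quadField d ≤ K₁ d)

/-- The first level `B₁` of the `ℤ₃`-extension of `ℚ`, as a subfield of `K₁`. -/
def B₁ (d : ℕ) : IntermediateField ℚ (K₁ d) :=
  IntermediateField.restrict (le_sup_right : cubicField ≤ K₁ d)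

/-- `ε` is a fundamental unit of the real quadratic field `K`: the units of `K` are exactly the
`± ε ^ n` with `n ∈ ℤ`. The unit normalized by `ε > 1` is one of the four such `ε`. -/
def IsFundamentalUnit {K : Type*} [Field K] (ε : (𝓞 K)ˣ) : Prop :=
  ∀ u : (𝓞 K)ˣ, ∃ n : ℤ, u = ε ^ n ∨ u = -(ε ^ n)

/-- The action of a field automorphism on units of the ring of integers. -/
def unitAct {K : Type*} [Field K] (σ : K ≃+* K) : (𝓞 K)ˣ →* (𝓞 K)ˣ :=
  Units.map (RingOfIntegers.mapRingHom (σ : K →+* K)).toMonoidHom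

/-- The `𝔽₃`-vector space `E/E³`, written additively, where `E` is the group of units of `K`. -/
abbrev UnitsModCubes (K : Type*) [Field K] : Type _ := ModN (Additive (𝓞 K)ˣ) 3

/-- The class in `E/E³` of a unit. -/
def unitClass {K : Type*} [Field K] (u : (𝓞 K)ˣ) : UnitsModCubes K :=
  ModN.mkQ 3 (Additive.ofMul u)

/-- The `𝔽₃`-linear action of a field automorphism on `E/E³`. -/
def actModCubes {K : Type*} [Field K] (σ : K ≃+* K) :
    UnitsModCubes K →ₗ[ZMod 3] UnitsModCubes K :=
  ModN.liftEquiv'.symm ⟨(ModN.mkQ 3).comp (unitAct σ).toAdditive, fun u => by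
    rw [← map_nsmul]
    refine (Submodule.Quotient.mk_eq_zero _).2 ⟨(unitAct σ).toAdditive u, ?_⟩
    rw [map_nsmul]
    exact natCast_zsmul _ 3⟩

theorem actModCubes_unitClass {K : Type*} [Field K] (σ : K ≃+* K) (u : (𝓞 K)ˣ) :
    actModCubes σ (unitClass u) = unitClass (unitAct σ u) := rfl

/-- `M = (E/E³)^{1-g}`: the image of `1 - g` on `E/E³`. -/
def M {K : Type*} [Field K] (g : K ≃+* K) : Submodule (ZMod 3) (UnitsModCubes K) :=
  LinearMap.range (1 - actModCubes g)

/-- `M[1-τ]`: the kernel of `1 - τ` on `M`. -/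
def MKer {K : Type*} [Field K] (g τ : K ≃+* K) : Submodule (ZMod 3) (UnitsModCubes K) :=
  M g ⊓ LinearMap.ker (1 - actModCubes τ)

/-- The classes of the units `u₀, u₁, u₂` lie in `M` and form a basis of `M` over `𝔽₃`. -/
def IsUnitBasis {K : Type*} [Field K] (g : K ≃+* K) (u₀ u₁ u₂ : (𝓞 K)ˣ) : Prop :=
  ∃ b : Module.Basis (Fin 3) (ZMod 3) (M g),
    (b 0 : UnitsModCubes K) = unitClass u₀ ∧ (b 1 : UnitsModCubes K) = unitClass u₁ ∧
      (b 2 : UnitsModCubes K) = unitClass u₂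

/-- The map from the class group of `K₀` to that of `K₁` induced by extension of ideals. -/
def classMap (d : ℕ) : ClassGroup (𝓞 (K₀ d)) →* ClassGroup (𝓞 (K₁ d)) :=
  ClassGroup.extendedHom (𝓞 (K₀ d)) (𝓞 (K₁ d))

/-- The norm map from the units of `K₁` to the units of `K₀`. -/
def unitNorm (d : ℕ) : (𝓞 (K₁ d))ˣ →* (𝓞 (K₀ d))ˣ :=
  Units.map (RingOfIntegers.norm (K₀ d))

/-- The inclusion of the units of `K₀` into the units of `K₁`. -/
def unitIncl (d : ℕ) : (𝓞 (K₀ d))ˣ →* (𝓞 (K₁ d))ˣ :=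
  Units.map (algebraMap (𝓞 (K₀ d)) (𝓞 (K₁ d))).toMonoidHom

/-- There are units `ε₁, ε₂` of `K₁` such that `{ε₀, ε₁, ε₂}` is a basis of `M`,
`ε₂^{1-τ} = ε₁` and `ε₂^{1+τ+τ²} = c`; the last two are equalities of units of `K₁`. -/
def HasSpecialBasis {K : Type*} [Field K] (g τ : K ≃+* K) (ε₀ c : (𝓞 K)ˣ) : Prop :=
  ∃ ε₁ ε₂ : (𝓞 K)ˣ, IsUnitBasis g ε₀ ε₁ ε₂ ∧ ε₂ / unitAct τ ε₂ = ε₁ ∧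
    ε₂ * unitAct τ ε₂ * unitAct τ (unitAct τ ε₂) = c

/-- Case (i). -/
structure CaseI (d : ℕ) (g τ : K₁ d ≃+* K₁ d) (ε₀ : (𝓞 (K₀ d))ˣ) : Prop where
  finrank_ker : Module.finrank (ZMod 3) (MKer g τ) = 1
  classMap_injective : Function.Injective (classMap d)
  unitNorm_surjective : Function.Surjective (unitNorm d)
  basis : HasSpecialBasis g τ (unitIncl d ε₀) (unitIncl d ε₀)

/-- Case (ii). -/
structure CaseII (d : ℕ) (g τ : K₁ d ≃+* K₁ d) (ε₀ : (𝓞 (K₀ d))ˣ) : Prop where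
  finrank_ker : Module.finrank (ZMod 3) (MKer g τ) = 2
  card_ker_classMap : Nat.card (classMap d).ker = 3
  card_coker_unitNorm : Nat.card ((𝓞 (K₀ d))ˣ ⧸ (unitNorm d).range) = 3
  basis : HasSpecialBasis g τ (unitIncl d ε₀) 1

end KummerUnits

end

/-! Write the units `E` of `K₁` additively, put `N = 1 + τ + τ²`, let `e` be the image of `ε₀`, and
let `L` be the group of units `v` with `g v = -v` and `N v = 0`. The dichotomy is whether `ε₀` is
the norm of a unit of `K₁`. Since `-1` and all cubes in `K₀` are norms, the cokernel of the norm is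
accordingly trivial or of order 3 (`unitNorm_surjective`, `card_coker_unitNorm`).

Module structure. The unit ranks 5 of `K₁` and 2 of `B₁` give `dim M = 3` (`finrank_M`). Two
identities do the rest: `(1-τ)² = N - 3τ` and `3 = N + (1-τ)(2+τ)`. If `e` is a norm, it is the norm
of some `x` in the minus part of `g`; then `(1-τ)² x ≡ e` modulo 3, so `1-τ` is a single Jordan
block on `M`, and `L ⊆ (1-τ)E` (`case_norm`). Otherwise Nakayama's lemma gives `x` in `L` outside
`(1-τ)L`; now `e, (1-τ)x, x` is a basis of `M`, the kernel of `1-τ` is a plane, and `L` modulo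
`(1-τ)E` is generated by `x ≠ 0` (`case_not_norm`).

Capitulation. If an ideal `J` of `K₀` becomes `(α)` in `K₁`, then `α/τα` is a unit of norm 1, and
its class modulo `(1-τ)E` determines the class of `J` and is determined by it. Because `J` times its
conjugate is generated by a rational integer, `g` acts on this class by inversion, so the class
comes from `L` (`exists_norm_one_unit`). Conversely, Hilbert 90 writes `v` in `L` as `α/τα`; the
ideal `(α)` is `τ`-stable, and its deviation from an ideal of `K₀` is a power of the unique prime
above 3, which `g` fixes. Dividing by the `g`-conjugate removes the deviation and yields a
capitulating ideal with class `v²` (`exists_ideal_of_unit`). So the capitulation kernel has the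
order of the image of `L` modulo `(1-τ)E`, namely 1 or 3. -/

namespace KummerUnits

/-! ### Linear algebra in `A/3A` and in three-dimensional spaces. -/

section ModThree

variable {A : Type*} [AddCommGroup A]

theorem mkQ_eq_zero_iff {x : A} : ModN.mkQ 3 x = 0 ↔ ∃ y : A, x = (3 : ℤ) • y := by
  refine (Submodule.Quotient.mk_eq_zero _).trans ⟨?_, ?_⟩
  · rintro ⟨y, rfl⟩
    exact ⟨y, by simp⟩
  · rintro ⟨y, rfl⟩
    exact ⟨y, by simp⟩

theorem mkQ_surjective : Function.Surjective (ModN.mkQ 3 : A → ModN A 3) :=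
  Submodule.mkQ_surjective _

theorem zmod_smul_mkQ (c : ZMod 3) (x : A) :
    c • (ModN.mkQ 3 x : ModN A 3) = ModN.mkQ 3 ((c.val : ℤ) • x) := by
  conv_lhs => rw [← ZMod.natCast_zmod_val c]
  rw [Nat.cast_smul_eq_nsmul, natCast_zsmul, map_nsmul]

theorem zmod_eq_zero_of_dvd_val {c : ZMod 3} (h : (3 : ℤ) ∣ (c.val : ℤ)) : c = 0 := by
  have := (ZMod.intCast_zmod_eq_zero_iff_dvd (c.val : ℤ) 3).2 (by exact_mod_cast h)
  simpa using this

/-- Three vectors of a three-dimensional subspace, linearly independent, form a basis of it. -/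
theorem exists_basis_of_linearIndependent {F V : Type*} [Field F] [AddCommGroup V] [Module F V]
    (W : Submodule F V) (hW : Module.finrank F W = 3) (x : Fin 3 → V) (hx : ∀ i, x i ∈ W)
    (hli : LinearIndependent F x) :
    ∃ b : Module.Basis (Fin 3) F W, ∀ i, (b i : V) = x i := by
  have hli' : LinearIndependent F (fun i => (⟨x i, hx i⟩ : W)) :=
    LinearIndependent.of_comp W.subtype hli
  have hc : Fintype.card (Fin 3) = Module.finrank F W := by simp [hW]
  exact ⟨basisOfLinearIndependentOfCardEqFinrank hli' hc, fun i => by simp⟩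

theorem exists_coeffs {F V : Type*} [Field F] [AddCommGroup V] [Module F V]
    {W : Submodule F V} (b : Module.Basis (Fin 3) F W) {m : V} (hm : m ∈ W) :
    ∃ c : Fin 3 → F, m = c 0 • (b 0 : V) + c 1 • (b 1 : V) + c 2 • (b 2 : V) := by
  refine ⟨fun i => b.repr ⟨m, hm⟩ i, ?_⟩
  have := congrArg (Subtype.val) (b.sum_repr ⟨m, hm⟩)
  rw [Fin.sum_univ_three] at this
  simpa using this.symm

/-- On a three-dimensional space a nilpotent operator with a cyclic vector has a
one-dimensional kernel. -/
theorem finrank_inf_ker_of_chain {F V : Type*} [Field F] [AddCommGroup V] [Module F V]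
    (W : Submodule F V) (hW : Module.finrank F W = 3) (T : V →ₗ[F] V) {x₀ x₁ x₂ : V}
    (h0 : x₀ ∈ W) (h1 : x₁ ∈ W) (h2 : x₂ ∈ W) (hT0 : T x₀ = 0) (hT1 : T x₁ = x₀)
    (hT2 : T x₂ = x₁) (hne : x₀ ≠ 0) :
    LinearIndependent F ![x₀, x₁, x₂] ∧ Module.finrank F (W ⊓ LinearMap.ker T : Submodule F V) = 1 := by
  have hli : LinearIndependent F ![x₀, x₁, x₂] := by
    rw [Fintype.linearIndependent_iff]
    intro c hc
    simp only [Fin.sum_univ_three, Matrix.cons_val_zero, Matrix.cons_val_one,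
      Matrix.cons_val] at hc
    have hc1 := congrArg T hc
    simp only [map_add, map_smul, hT0, hT1, hT2, smul_zero, zero_add, map_zero] at hc1
    have hc2 := congrArg T hc1
    simp only [map_add, map_smul, hT0, hT1, smul_zero, zero_add, map_zero] at hc2
    have e2 : c 2 = 0 := (smul_eq_zero.1 hc2).resolve_right hne
    rw [e2, zero_smul, add_zero] at hc1
    have e1 : c 1 = 0 := (smul_eq_zero.1 hc1).resolve_right hne
    rw [e2, e1, zero_smul, zero_smul, add_zero, add_zero] at hc
    have e0 : c 0 = 0 := (smul_eq_zero.1 hc).resolve_right hne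
    intro i
    fin_cases i
    exacts [e0, e1, e2]
  refine ⟨hli, ?_⟩
  obtain ⟨b, hb⟩ := exists_basis_of_linearIndependent W hW ![x₀, x₁, x₂]
    (by intro i; fin_cases i <;> assumption) hli
  have b0 : (b 0 : V) = x₀ := hb 0
  have b1 : (b 1 : V) = x₁ := hb 1
  have b2 : (b 2 : V) = x₂ := hb 2
  refine finrank_eq_one_iff'.2 ⟨⟨x₀, h0, hT0⟩, by simpa [Subtype.ext_iff] using hne, ?_⟩
  rintro ⟨m, hm, hmT⟩
  obtain ⟨c, hc⟩ := exists_coeffs b hm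
  rw [b0, b1, b2] at hc
  have hmT' : T m = 0 := hmT
  rw [hc] at hmT'
  simp only [map_add, map_smul, hT0, hT1, hT2, smul_zero, zero_add] at hmT'
  have hc2 := congrArg T hmT'
  simp only [map_add, map_smul, hT0, hT1, smul_zero, zero_add, map_zero] at hc2
  have e2 : c 2 = 0 := (smul_eq_zero.1 hc2).resolve_right hne
  rw [e2, zero_smul, add_zero] at hmT'
  have e1 : c 1 = 0 := (smul_eq_zero.1 hmT').resolve_right hne
  refine ⟨c 0, Subtype.ext ?_⟩
  simp [hc, e1, e2]

/-- On a three-dimensional space an operator of rank one which kills two basis vectors has a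
two-dimensional kernel. -/
theorem finrank_inf_ker_of_basis {F V : Type*} [Field F] [AddCommGroup V] [Module F V]
    (W : Submodule F V) (T : V →ₗ[F] V) (b : Module.Basis (Fin 3) F W)
    (hT0 : T (b 0) = 0) (hT1 : T (b 1) = 0) (hT2 : T (b 2) = b 1) :
    Module.finrank F (W ⊓ LinearMap.ker T : Submodule F V) = 2 := by
  have hli : LinearIndependent F ![(b 0 : V), (b 1 : V)] := by
    have h := (b.linearIndependent.map' W.subtype W.ker_subtype).comp ![0, 1]
      (by intro i j; fin_cases i <;> fin_cases j <;> simp)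
    have he : ![(b 0 : V), (b 1 : V)] = (W.subtype ∘ b) ∘ ![0, 1] := by
      ext i
      fin_cases i <;> rfl
    rw [he]
    exact h
  have hspan : (W ⊓ LinearMap.ker T : Submodule F V) =
      Submodule.span F (Set.range ![(b 0 : V), (b 1 : V)]) := by
    apply le_antisymm
    · rintro m ⟨hm, hmT⟩
      obtain ⟨c, hc⟩ := exists_coeffs b hm
      have hmT' : T m = 0 := hmT
      rw [hc] at hmT'
      simp only [map_add, map_smul, hT0, hT1, hT2, smul_zero, zero_add] at hmT'
      have hne : (b 1 : V) ≠ 0 := by simpa using b.ne_zero 1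
      have e2 : c 2 = 0 := (smul_eq_zero.1 hmT').resolve_right hne
      rw [hc, e2, zero_smul, add_zero]
      exact add_mem (Submodule.smul_mem _ _ (Submodule.subset_span ⟨0, rfl⟩))
        (Submodule.smul_mem _ _ (Submodule.subset_span ⟨1, rfl⟩))
    · rw [Submodule.span_le]
      rintro _ ⟨i, rfl⟩
      fin_cases i
      · exact ⟨(b 0).2, hT0⟩
      · exact ⟨(b 1).2, hT1⟩
  rw [hspan, finrank_span_eq_card hli]
  simp

end ModThree

/-- The properties of the unit group of `K₁` as a Galois module used in the classification. Here
`e` is the image of the fundamental unit of `K₀` and `t` that of `-1`. -/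
structure UnitModule {A : Type*} [AddCommGroup A] (g τ : A →+ A) (e t : A) : Prop where
  g_g : ∀ x, g (g x) = x
  τ_τ_τ : ∀ x, τ (τ (τ x)) = x
  g_τ : ∀ x, g (τ x) = τ (g x)
  two_t : (2 : ℤ) • t = 0
  torsion : ∀ (n : ℤ) (x : A), n ≠ 0 → n • x = 0 → x = 0 ∨ x = t
  fixed : ∀ x, τ x = x → ∃ n : ℤ, x = n • e ∨ x = n • e + t
  τ_e : τ e = e
  τ_t : τ t = t
  g_e : g e = -e ∨ g e = -e + t
  e_free : ∀ n : ℤ, n • e = 0 → n = 0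

/-! ### The unit group as an abstract module under `g` and `τ`; the case where `e` is a norm. -/

namespace UnitModule

variable {A : Type*} [AddCommGroup A] {g τ : A →+ A} {e t : A} (h : UnitModule g τ e t)

include h

theorem three_t : (3 : ℤ) • t = t := by
  have := h.two_t
  have h3 : (3 : ℤ) • t = (2 : ℤ) • t + t := by module
  rw [h3, this, zero_add]

theorem eq_zero_of_three {x : A} (hx : (3 : ℤ) • x = 0) : x = 0 := by
  rcases h.torsion 3 x (by norm_num) hx with h0 | rfl
  · exact h0
  · rwa [h.three_t] at hx

/-- Uniqueness of cube roots: the only possible nonzero torsion element is `t`, and `3t = t`. -/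
theorem three_inj {x y : A} (hxy : (3 : ℤ) • x = (3 : ℤ) • y) : x = y := by
  rw [← sub_eq_zero, ← smul_sub] at hxy
  exact sub_eq_zero.1 (h.eq_zero_of_three hxy)

theorem mkQ_t : (ModN.mkQ 3 t : ModN A 3) = 0 := mkQ_eq_zero_iff.2 ⟨t, h.three_t.symm⟩

theorem norm_fixed (x : A) : τ (x + τ x + τ (τ x)) = x + τ x + τ (τ x) := by
  rw [map_add, map_add, h.τ_τ_τ]
  abel

theorem eq_zero_of_smul_e {n : ℤ} (hn : n • e = 0 ∨ n • e + t = 0) : n = 0 := by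
  rcases hn with hn | hn
  · exact h.e_free n hn
  · have h2 : (2 * n) • e = (2 : ℤ) • (n • e + t) - (2 : ℤ) • t := by module
    rw [hn, h.two_t, smul_zero, sub_zero] at h2
    have := h.e_free _ h2
    omega

/-- Modulo 3, `(1-g)(-v) = -2v = v`. -/
theorem mem_range_of_anti (gb : ModN A 3 →ₗ[ZMod 3] ModN A 3)
    (hgb : ∀ x, gb (ModN.mkQ 3 x) = ModN.mkQ 3 (g x)) {v : A}
    (hv : g v = -v ∨ g v = -v + t) : (ModN.mkQ 3 v : ModN A 3) ∈ LinearMap.range (1 - gb) := by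
  have hv' : (ModN.mkQ 3 (g v) : ModN A 3) = - ModN.mkQ 3 v := by
    rcases hv with hv | hv
    · rw [hv, map_neg]
    · rw [hv, map_add, map_neg, h.mkQ_t, add_zero]
  refine ⟨ModN.mkQ 3 (-v), ?_⟩
  rw [LinearMap.sub_apply, hgb, Module.End.one_apply, map_neg, map_neg, map_neg, hv', neg_neg]
  have : (ModN.mkQ 3 ((3 : ℤ) • v) : ModN A 3) = 0 := mkQ_eq_zero_iff.2 ⟨v, rfl⟩
  rw [show (3 : ℤ) • v = v + v + v by module, map_add, map_add] at this
  rw [← sub_eq_zero, ← neg_eq_zero, ← this]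
  abel

theorem sub_g_anti (w : A) : g (w - g w) = -(w - g w) := by
  rw [map_sub, h.g_g]
  abel

theorem exists_rep {gb : ModN A 3 →ₗ[ZMod 3] ModN A 3}
    (hgb : ∀ x, gb (ModN.mkQ 3 x) = ModN.mkQ 3 (g x))
    (b : Module.Basis (Fin 3) (ZMod 3) (LinearMap.range (1 - gb))) {x₀ x₁ x₂ v : A}
    (h0 : (b 0 : ModN A 3) = ModN.mkQ 3 x₀) (h1 : (b 1 : ModN A 3) = ModN.mkQ 3 x₁)
    (h2 : (b 2 : ModN A 3) = ModN.mkQ 3 x₂) (hv : g v = -v) :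
    ∃ (k l m : ℤ) (y : A), v = k • x₀ + l • x₁ + m • x₂ + (3 : ℤ) • y := by
  obtain ⟨c, hc⟩ := exists_coeffs b (h.mem_range_of_anti gb hgb (Or.inl hv))
  rw [h0, h1, h2, zmod_smul_mkQ, zmod_smul_mkQ, zmod_smul_mkQ, ← map_add, ← map_add,
    ← sub_eq_zero, ← map_sub, mkQ_eq_zero_iff] at hc
  obtain ⟨y, hy⟩ := hc
  exact ⟨_, _, _, y, by rw [← hy]; abel⟩

/-- By uniqueness of cube roots, a cube root of `e` is fixed by `τ`, hence up to `t` a multiple of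
`e`, against the freeness of `e`. -/
theorem e_ne_three_smul (y : A) : e ≠ (3 : ℤ) • y := by
  intro hy
  have hτy : τ y = y := by
    apply h.three_inj
    rw [← map_zsmul, ← hy, h.τ_e]
  obtain ⟨n, hn⟩ := h.fixed y hτy
  have : (3 * n - 1) • e = 0 ∨ (3 * n - 1) • e + t = 0 := by
    rcases hn with hn | hn
    · left
      rw [hn] at hy
      have h1 : (3 * n - 1) • e = (3 : ℤ) • n • e - e := by module
      rw [h1, ← hy, sub_self]
    · right
      rw [hn, smul_add, h.three_t] at hy
      have h1 : (3 * n - 1) • e + t = ((3 : ℤ) • n • e + t) - e := by module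
      rw [h1, ← hy, sub_self]
  have := h.eq_zero_of_smul_e this
  omega

theorem mkQ_e_ne_zero : (ModN.mkQ 3 e : ModN A 3) ≠ 0 := by
  rw [Ne, mkQ_eq_zero_iff]
  rintro ⟨y, hy⟩
  exact h.e_ne_three_smul y hy

/-- The case in which the fundamental unit is a norm. -/
theorem case_norm {gb τb : ModN A 3 →ₗ[ZMod 3] ModN A 3}
    (hgb : ∀ x, gb (ModN.mkQ 3 x) = ModN.mkQ 3 (g x))
    (hτb : ∀ x, τb (ModN.mkQ 3 x) = ModN.mkQ 3 (τ x))
    (hM : Module.finrank (ZMod 3) (LinearMap.range (1 - gb)) = 3)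
    (hη : ∃ η, η + τ η + τ (τ η) = e) :
    Module.finrank (ZMod 3)
        (LinearMap.range (1 - gb) ⊓ LinearMap.ker (1 - τb) : Submodule _ (ModN A 3)) = 1 ∧
      (∃ x : A, x + τ x + τ (τ x) = e ∧
        ∃ b : Module.Basis (Fin 3) (ZMod 3) (LinearMap.range (1 - gb)),
          (b 0 : ModN A 3) = ModN.mkQ 3 e ∧ (b 1 : ModN A 3) = ModN.mkQ 3 (x - τ x) ∧
            (b 2 : ModN A 3) = ModN.mkQ 3 x) ∧
      ∀ v, g v = -v → v + τ v + τ (τ v) = 0 → ∃ w, v = w - τ w := by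
  obtain ⟨η, hη⟩ := hη
  -- The norm of `η - gη` is `2e` up to `t`. Doubling removes `t` and gives `4e`; subtracting `e`,
  -- of norm `3e`, leaves `e`.
  obtain ⟨x, hx⟩ : ∃ x : A, x = (2 : ℤ) • (η - g η) - e := ⟨_, rfl⟩
  have hge : (2 : ℤ) • g e = (2 : ℤ) • (-e) := by
    rcases h.g_e with h1 | h1
    · rw [h1]
    · rw [h1, smul_add, h.two_t, add_zero]
  have hNx : x + τ x + τ (τ x) = e := by
    have h1 : x + τ x + τ (τ x) =
        (2 : ℤ) • (η + τ η + τ (τ η)) - (2 : ℤ) • g (η + τ η + τ (τ η)) - (3 : ℤ) • e := by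
      simp only [hx, map_sub, map_zsmul, map_add, h.τ_e, h.g_τ]
      module
    rw [h1, hη, hge]
    module
  have hgx : g x = -x ∨ g x = -x + t := by
    have h1 : g x = -x - e - g e := by
      simp only [hx, map_sub, map_zsmul, h.g_g]
      module
    rcases h.g_e with h2 | h2
    · left
      rw [h1, h2]
      abel
    · right
      have h3 : -x - e - (-e + t) = -x + t - (2 : ℤ) • t := by module
      rw [h1, h2, h3, h.two_t, sub_zero]
  have hgτ : ∀ {y : A}, (g y = -y ∨ g y = -y + t) → g (y - τ y) = -(y - τ y) := by
    rintro y (hy | hy)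
    · rw [map_sub, h.g_τ, hy, map_neg]
      abel
    · rw [map_sub, h.g_τ, hy, map_add, map_neg, h.τ_t]
      abel
  have hT : ∀ y : A, (1 - τb) (ModN.mkQ 3 y) = ModN.mkQ 3 (y - τ y) := fun y => by
    rw [LinearMap.sub_apply, hτb, Module.End.one_apply, map_sub]
  have h0 := h.mem_range_of_anti gb hgb h.g_e
  have h1 := h.mem_range_of_anti gb hgb (Or.inl (hgτ hgx))
  have h2 := h.mem_range_of_anti gb hgb hgx
  have hT0 : (1 - τb) (ModN.mkQ 3 e) = 0 := by rw [hT, h.τ_e, sub_self, map_zero]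
  -- This is `(1-τ)² = N - 3τ` applied to `x`.
  have hT1 : (1 - τb) (ModN.mkQ 3 (x - τ x)) = ModN.mkQ 3 e := by
    rw [hT, ← sub_eq_zero, ← map_sub, mkQ_eq_zero_iff]
    refine ⟨-τ x, ?_⟩
    rw [map_sub]
    linear_combination (norm := module) hNx
  obtain ⟨hli, hrank⟩ := finrank_inf_ker_of_chain _ hM (1 - τb) h0 h1 h2 hT0 hT1 (hT x)
    h.mkQ_e_ne_zero
  obtain ⟨b, hb⟩ := exists_basis_of_linearIndependent _ hM _
    (by intro i; fin_cases i <;> assumption) hli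
  refine ⟨hrank, ⟨x, hNx, b, hb 0, hb 1, hb 2⟩, fun v hgv hNv => ?_⟩
  obtain ⟨k, l, m, y, rfl⟩ := h.exists_rep hgb b (hb 0) (hb 1) (hb 2) hgv
  have hNv' : (3 * k + m) • e + (3 : ℤ) • (y + τ y + τ (τ y)) = 0 := by
    rw [← hNv]
    simp only [map_add, map_sub, map_zsmul, h.τ_e, h.τ_τ_τ]
    have h4 : (3 * k + m) • e = (3 * k) • e + m • (x + τ x + τ (τ x)) := by
      rw [hNx]
      module
    rw [h4]
    module
  obtain ⟨n, hn⟩ := h.fixed _ (h.norm_fixed y)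
  have hn' : ∃ s : A, (s = 0 ∨ s = t) ∧ y + τ y + τ (τ y) = n • e + s := by
    rcases hn with hn | hn
    · exact ⟨0, Or.inl rfl, by rw [hn, add_zero]⟩
    · exact ⟨t, Or.inr rfl, hn⟩
  obtain ⟨s, hs, hn⟩ := hn'
  have hs3 : (3 : ℤ) • s = s := by
    rcases hs with rfl | rfl
    · simp
    · exact h.three_t
  have h5 : (3 * k + m + 3 * n) • e + s = 0 := by
    rw [← hNv', hn, smul_add, hs3]
    module
  have h6 : 3 * k + m + 3 * n = 0 := by
    apply h.eq_zero_of_smul_e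
    rcases hs with rfl | rfl
    · left
      rwa [add_zero] at h5
    · right
      exact h5
  have hs0 : s = 0 := by rwa [h6, zero_smul, zero_add] at h5
  rw [hs0, add_zero] at hn
  obtain rfl : m = -3 * (k + n) := by linarith
  -- Both `3y` and `m x = -3(k+n)x` are rewritten with `3 = N + (1-τ)(2+τ)`; the multiples of `e`
  -- then cancel.
  refine ⟨l • x + (y + y + τ y) - (k + n) • (x + x + τ x), ?_⟩
  have h7 : (3 : ℤ) • y = n • e + ((y + y + τ y) - τ (y + y + τ y)) := by
    rw [← hn]
    simp only [map_add]
    module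
  have h8 : k • e = (k + n) • (x + τ x + τ (τ x)) - n • e := by
    rw [hNx]
    module
  rw [h7, h8]
  simp only [map_add, map_sub, map_zsmul]
  module

end UnitModule

end KummerUnits

namespace KummerUnits

/-! ### The case where `e` is not a norm. -/

namespace UnitModule

variable {A : Type*} [AddCommGroup A] {g τ : A →+ A} {e t : A} (h : UnitModule g τ e t)

/-- On the kernel of `N`, the identity `(1-τ)² = N - 3τ` makes `1-τ` a square root of 3 up to an
automorphism. -/
theorem sub_τ_sub_τ {τ : A →+ A} {v : A} (hv : v + τ v + τ (τ v) = 0) :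
    (v - τ v) - τ (v - τ v) = -((3 : ℤ) • τ v) := by
  rw [map_sub]
  linear_combination (norm := module) hv

include h

/-- Since `N e = 3e`, the integer `a` matters only modulo 3; if it were `±1`, then `e` would be a
norm. -/
theorem dvd_of_norm_eq (hno : ¬ ∃ η, η + τ η + τ (τ η) = e) {y : A} {a : ℤ}
    (hy : y + τ y + τ (τ y) = a • e) : 3 ∣ a := by
  by_contra hnd
  rcases (by omega : a % 3 = 1 ∨ a % 3 = 2) with ha | ha
  · obtain ⟨q, rfl⟩ : ∃ q, a = 3 * q + 1 := ⟨a / 3, by omega⟩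
    refine hno ⟨y - q • e, ?_⟩
    simp only [map_sub, map_zsmul, h.τ_e]
    linear_combination (norm := module) hy
  · obtain ⟨q, rfl⟩ : ∃ q, a = 3 * q + 2 := ⟨a / 3, by omega⟩
    refine hno ⟨(q + 1) • e - y, ?_⟩
    simp only [map_sub, map_zsmul, h.τ_e]
    linear_combination (norm := module) -hy

theorem norm_sub_τ (w : A) : (w - τ w) + τ (w - τ w) + τ (τ (w - τ w)) = 0 := by
  simp only [map_sub, h.τ_τ_τ]
  abel

theorem g_sub_τ {v : A} (hv : g v = -v) : g (v - τ v) = -(v - τ v) := by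
  rw [map_sub, h.g_τ, hv, map_neg]
  abel

theorem eq_zero_of_fixed {v : A} (hf : τ v = v) (hv : v + τ v + τ (τ v) = 0) : v = 0 := by
  rw [hf, hf] at hv
  apply h.eq_zero_of_three
  rw [← hv]
  module

/-- There are nontrivial units of relative norm `1` to both subfields. -/
theorem exists_ne_zero {gb : ModN A 3 →ₗ[ZMod 3] ModN A 3}
    (hgb : ∀ x, gb (ModN.mkQ 3 x) = ModN.mkQ 3 (g x))
    (hM : Module.finrank (ZMod 3) (LinearMap.range (1 - gb)) = 3) :
    ∃ v, g v = -v ∧ v + τ v + τ (τ v) = 0 ∧ v ≠ 0 := by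
  by_contra! hall
  -- If there were no such unit, `(1-τ)(1-g)w` would vanish for all `w`, so `(1-g)w` would be fixed
  -- by `τ` and `M` would be spanned by `e`.
  have hle : LinearMap.range (1 - gb) ≤ Submodule.span (ZMod 3) {ModN.mkQ 3 e} := by
    rintro _ ⟨w, rfl⟩
    obtain ⟨w, rfl⟩ := mkQ_surjective w
    have h1 := hall _ (h.g_sub_τ (h.sub_g_anti w)) (h.norm_sub_τ _)
    obtain ⟨n, hn⟩ := h.fixed _ (sub_eq_zero.1 h1).symm
    have h2 : (1 - gb) (ModN.mkQ 3 w) = n • ModN.mkQ 3 e := by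
      rw [LinearMap.sub_apply, hgb, Module.End.one_apply, ← map_sub]
      rcases hn with hn | hn
      · rw [hn, map_zsmul]
      · rw [hn, map_add, h.mkQ_t, add_zero, map_zsmul]
    rw [h2]
    exact zsmul_mem (Submodule.mem_span_singleton_self _) n
  have h3 := (Submodule.finrank_mono hle).trans (finrank_span_le_card _)
  rw [hM] at h3
  simp at h3

/-- There is a unit of relative norm `1` to both subfields which is not of the form `w - τ w` for
such a unit `w`. -/
theorem exists_not_sub_τ [Module.Finite ℤ A] {gb : ModN A 3 →ₗ[ZMod 3] ModN A 3}
    (hgb : ∀ x, gb (ModN.mkQ 3 x) = ModN.mkQ 3 (g x))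
    (hM : Module.finrank (ZMod 3) (LinearMap.range (1 - gb)) = 3) :
    ∃ v, g v = -v ∧ v + τ v + τ (τ v) = 0 ∧
      ∀ u, g u = -u → u + τ u + τ (τ u) = 0 → v ≠ u - τ u := by
  by_contra! hall
  obtain ⟨v, hgv, hNv, hv0⟩ := h.exists_ne_zero hgb hM
  let L : Submodule ℤ A :=
    { carrier := {v | g v = -v ∧ v + τ v + τ (τ v) = 0}
      add_mem' := by
        rintro a b ⟨ha, ha'⟩ ⟨hb, hb'⟩
        refine ⟨by rw [map_add, ha, hb]; abel, ?_⟩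
        simp only [map_add]
        linear_combination (norm := module) ha' + hb'
      zero_mem' := by simp
      smul_mem' := by
        rintro n a ⟨ha, ha'⟩
        refine ⟨by rw [map_zsmul, ha, smul_neg], ?_⟩
        simp only [map_zsmul]
        rw [← smul_add, ← smul_add, ha', smul_zero] }
  -- If `L = (1-τ)L`, then `L = (1-τ)²L = 3L`.
  have hL : L ≤ Ideal.span {(3 : ℤ)} • L := by
    rintro a ⟨ha, ha'⟩
    obtain ⟨b, hb, hb', rfl⟩ := hall a ha ha'
    obtain ⟨c, hc, hc', rfl⟩ := hall b hb hb'
    rw [sub_τ_sub_τ hc', ← smul_neg]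
    refine Submodule.smul_mem_smul (Ideal.mem_span_singleton_self _) ⟨?_, ?_⟩
    · rw [map_neg, h.g_τ, hc, map_neg]
    · simp only [map_neg]
      rw [h.τ_τ_τ]
      linear_combination (norm := module) -hc'
  -- By Nakayama some `r ≡ 1` modulo 3 kills `L`, so `v` is torsion; `v = t` is excluded because `N
  -- t = 3t = t`.
  obtain ⟨r, hr, hr'⟩ := Submodule.exists_sub_one_mem_and_smul_eq_zero_of_fg_of_le_smul _ L
    (IsNoetherian.noetherian L) hL
  rw [Ideal.mem_span_singleton] at hr
  rcases h.torsion r v (by rintro rfl; norm_num at hr) (hr' v ⟨hgv, hNv⟩) with h0 | h0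
  · exact hv0 h0
  · rw [h0, h.τ_t, h.τ_t] at hNv
    apply hv0
    rw [h0, ← h.three_t, ← hNv]
    module

/-- The case in which the fundamental unit is not a norm. -/
theorem case_not_norm [Module.Finite ℤ A] {gb τb : ModN A 3 →ₗ[ZMod 3] ModN A 3}
    (hgb : ∀ x, gb (ModN.mkQ 3 x) = ModN.mkQ 3 (g x))
    (hτb : ∀ x, τb (ModN.mkQ 3 x) = ModN.mkQ 3 (τ x))
    (hM : Module.finrank (ZMod 3) (LinearMap.range (1 - gb)) = 3)
    (hno : ¬ ∃ η, η + τ η + τ (τ η) = e) :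
    Module.finrank (ZMod 3)
        (LinearMap.range (1 - gb) ⊓ LinearMap.ker (1 - τb) : Submodule _ (ModN A 3)) = 2 ∧
      ∃ x : A, (g x = -x ∧ x + τ x + τ (τ x) = 0 ∧
        ∃ b : Module.Basis (Fin 3) (ZMod 3) (LinearMap.range (1 - gb)),
          (b 0 : ModN A 3) = ModN.mkQ 3 e ∧ (b 1 : ModN A 3) = ModN.mkQ 3 (x - τ x) ∧
            (b 2 : ModN A 3) = ModN.mkQ 3 x) ∧
      (∀ w, x ≠ w - τ w) ∧
      ∀ v, g v = -v → v + τ v + τ (τ v) = 0 → ∃ (k : ℤ) (w : A), v = k • x + (w - τ w) := by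
  obtain ⟨x, hgx, hNx, hx⟩ := h.exists_not_sub_τ hgb hM
  have hx1 : ∀ y, x - τ x ≠ (3 : ℤ) • y := by
    intro y hy
    have hgy : g y = -y := by
      apply h.three_inj
      rw [← map_zsmul, ← hy, h.g_sub_τ hgx, hy, smul_neg]
    have hNy : y + τ y + τ (τ y) = 0 := by
      apply h.eq_zero_of_three
      rw [smul_add, smul_add, ← map_zsmul, ← map_zsmul, ← map_zsmul, ← hy, h.norm_sub_τ]
    -- Chosen so that `(1-τ)² z = -3τz = 3y = (1-τ)x`; then `x - (1-τ)z` is fixed by `τ` and has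
    -- norm 0, hence vanishes.
    set z : A := -τ (τ y) with hz
    have hgz : g z = -z := by rw [hz, map_neg, h.g_τ, h.g_τ, hgy, map_neg, map_neg]
    have hNz : z + τ z + τ (τ z) = 0 := by
      simp only [hz, map_neg, h.τ_τ_τ]
      linear_combination (norm := module) -hNy
    have hzy : y = -τ z := by rw [hz, map_neg, h.τ_τ_τ, neg_neg]
    have h1 : τ (x - (z - τ z)) = x - (z - τ z) := by
      have h2 := sub_τ_sub_τ hNz
      rw [map_sub]
      rw [hzy] at hy
      linear_combination (norm := module) h2 - hy
    have h3 : x - (z - τ z) = 0 := by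
      apply h.eq_zero_of_fixed h1
      have h4 := h.norm_sub_τ z
      simp only [map_sub] at h4 ⊢
      linear_combination (norm := module) hNx - h4
    exact hx z hgz hNz (sub_eq_zero.1 h3)
  -- Applying `N` gives `N y = k e`, so 3 divides `k` because `e` is not a norm. Applying `1-τ`
  -- isolates `m (1-τ)x` modulo 3, and what remains then isolates `l`.
  have hind : ∀ (k l m : ℤ) (y : A), k • e + l • (x - τ x) + m • x = (3 : ℤ) • y →
      3 ∣ k ∧ 3 ∣ l ∧ 3 ∣ m := by
    intro k l m y hy
    have hN : y + τ y + τ (τ y) = k • e := by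
      apply h.three_inj
      rw [smul_add, smul_add, ← map_zsmul, ← map_zsmul, ← map_zsmul, ← hy]
      have h1 := h.norm_sub_τ x
      simp only [map_add, map_sub, map_zsmul, h.τ_e] at h1 ⊢
      linear_combination (norm := module) l • h1 + m • hNx
    obtain ⟨q, rfl⟩ := h.dvd_of_norm_eq hno hN
    have key : ∀ (n : ℤ) (y : A), n • (x - τ x) = (3 : ℤ) • y → 3 ∣ n := by
      intro n y hy
      by_contra hnd
      rcases (by omega : n % 3 = 1 ∨ n % 3 = 2) with ha | ha
      · obtain ⟨q, rfl⟩ : ∃ q, n = 3 * q + 1 := ⟨n / 3, by omega⟩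
        refine hx1 (y - q • (x - τ x)) ?_
        linear_combination (norm := module) hy
      · obtain ⟨q, rfl⟩ : ∃ q, n = 3 * q + 2 := ⟨n / 3, by omega⟩
        refine hx1 ((q + 1) • (x - τ x) - y) ?_
        linear_combination (norm := module) -hy
    have hm : 3 ∣ m := by
      apply key m (y - τ y + l • τ x)
      have h2 := congrArg τ hy
      have h3 := sub_τ_sub_τ hNx
      simp only [map_add, map_sub, map_zsmul, h.τ_e] at h2 h3
      linear_combination (norm := module) hy - h2 - l • h3
    obtain ⟨p, rfl⟩ := hm
    refine ⟨⟨q, rfl⟩, key l (y - q • e - p • x) ?_, ⟨p, rfl⟩⟩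
    linear_combination (norm := module) hy
  have hli : LinearIndependent (ZMod 3)
      ![(ModN.mkQ 3 e : ModN A 3), ModN.mkQ 3 (x - τ x), ModN.mkQ 3 x] := by
    rw [Fintype.linearIndependent_iff]
    intro c hc
    simp only [Fin.sum_univ_three, Matrix.cons_val_zero, Matrix.cons_val_one,
      Matrix.cons_val] at hc
    rw [zmod_smul_mkQ, zmod_smul_mkQ, zmod_smul_mkQ, ← map_add, ← map_add,
      mkQ_eq_zero_iff] at hc
    obtain ⟨y, hy⟩ := hc
    obtain ⟨h0, h1, h2⟩ := hind _ _ _ _ hy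
    intro i
    fin_cases i
    exacts [zmod_eq_zero_of_dvd_val h0, zmod_eq_zero_of_dvd_val h1, zmod_eq_zero_of_dvd_val h2]
  have hT : ∀ y : A, (1 - τb) (ModN.mkQ 3 y) = ModN.mkQ 3 (y - τ y) := fun y => by
    rw [LinearMap.sub_apply, hτb, Module.End.one_apply, map_sub]
  have h0 := h.mem_range_of_anti gb hgb h.g_e
  have h1 := h.mem_range_of_anti gb hgb (Or.inl (h.g_sub_τ hgx))
  have h2 := h.mem_range_of_anti gb hgb (Or.inl hgx)
  obtain ⟨b, hb⟩ := exists_basis_of_linearIndependent _ hM _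
    (by intro i; fin_cases i <;> assumption) hli
  have b0 : (b 0 : ModN A 3) = ModN.mkQ 3 e := hb 0
  have b1 : (b 1 : ModN A 3) = ModN.mkQ 3 (x - τ x) := hb 1
  have b2 : (b 2 : ModN A 3) = ModN.mkQ 3 x := hb 2
  refine ⟨?_, x, ⟨hgx, hNx, b, b0, b1, b2⟩, ?_, ?_⟩
  · apply finrank_inf_ker_of_basis _ _ b
    · rw [b0, hT, h.τ_e, sub_self, map_zero]
    · rw [b1, hT, sub_τ_sub_τ hNx, mkQ_eq_zero_iff]
      exact ⟨-τ x, by module⟩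
    · rw [b2, b1, hT]
  · intro w hw
    -- If `x = (1-τ)w` with `w` arbitrary, then `(1-τ)(w - gw) = 2x`. Expanding `w - gw` in the
    -- basis turns this into a relation modulo 3 whose `x`-coefficient is 2.
    obtain ⟨k, l, m, y, hz⟩ := h.exists_rep hgb b b0 b1 b2 (h.sub_g_anti w)
    have h3 : (w - g w) - τ (w - g w) = (2 : ℤ) • x := by
      rw [map_sub, ← h.g_τ]
      have h4 : g x = g w - g (τ w) := by rw [hw, map_sub]
      linear_combination (norm := module) -hw - hgx + h4
    have h5 := (hind 0 (-m) 2 (y - τ y - l • τ x) ?_).2.2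
    · norm_num at h5
    · rw [hz] at h3
      have h6 := sub_τ_sub_τ hNx
      simp only [map_add, map_sub, map_zsmul, h.τ_e] at h3 h6
      linear_combination (norm := module) -h3 + l • h6
  · intro v hgv hNv
    obtain ⟨k, l, m, y, rfl⟩ := h.exists_rep hgb b b0 b1 b2 hgv
    -- Here `k` is a multiple of 3, so `k e` cancels the `N y` in `3y = N y + (1-τ)(2+τ)y`.
    have hN : y + τ y + τ (τ y) = (-k) • e := by
      apply h.three_inj
      have h1 := h.norm_sub_τ x
      simp only [map_add, map_sub, map_zsmul, h.τ_e] at h1 hNv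
      linear_combination (norm := module) hNv - l • h1 - m • hNx
    obtain ⟨q, hq⟩ := h.dvd_of_norm_eq hno hN
    obtain rfl : k = -(3 * q) := by omega
    refine ⟨m, l • x + (y + y + τ y), ?_⟩
    simp only [map_add, map_zsmul]
    linear_combination (norm := module) hN

end UnitModule

end KummerUnits

namespace KummerUnits

/-! ### Ideals of a quadratic ring times their conjugates. -/

section Quadratic

variable {S : Type*} [CommRing S] [IsDedekindDomain S]

/-- The quotient `z/c` is a root of `X² - aX + b`, and `S` is integrally closed. -/
theorem dvd_of_sq_dvd_norm (K : Type*) [Field K] [Algebra S K] [IsFractionRing S K] {c z z' a b : S} (h1 : z + z' = c * a) (h2 : z * z' = c ^ 2 * b)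
    (hz : c = 0 → z = 0) : c ∣ z := by
  by_cases hc : c = 0
  · rw [hz hc]
    exact dvd_zero c
  have hroot : z ^ 2 - c * a * z + c ^ 2 * b = 0 := by
    linear_combination z * h1 - h2
  have hcK : algebraMap S K c ≠ 0 := by
    simpa using hc
  have hintegral : IsIntegral S (algebraMap S K z / algebraMap S K c) := by
    refine ⟨Polynomial.X ^ 2 - Polynomial.C a * Polynomial.X + Polynomial.C b, by monicity!, ?_⟩
    have := congrArg (algebraMap S K) hroot
    simp only [map_add, map_sub, map_mul, map_pow, map_zero] at this
    simp only [Polynomial.eval₂_add, Polynomial.eval₂_sub, Polynomial.eval₂_mul,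
      Polynomial.eval₂_pow, Polynomial.eval₂_X, Polynomial.eval₂_C]
    field_simp
    linear_combination this
  obtain ⟨y, hy⟩ := IsIntegrallyClosed.isIntegral_iff.1 hintegral
  refine ⟨y, ?_⟩
  apply IsFractionRing.injective S K
  rw [map_mul, hy]
  field_simp

/-- In a quadratic extension, the product of an ideal and its conjugate is generated by a rational
integer. -/
theorem exists_mul_conj_eq_span_int (σ : S ≃+* S) (hσ : ∀ x, σ (σ x) = x)
    (hfix : ∀ x, σ x = x → ∃ n : ℤ, x = n) (J : Ideal S) :
    ∃ n : ℤ, J * J.map (σ : S →+* S) = Ideal.span {(n : S)} := by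
  by_cases hJ : J = ⊥
  · exact ⟨0, by simp [hJ]⟩
  obtain ⟨x, hxJ, hx0⟩ := Submodule.exists_mem_ne_zero_of_ne_bot hJ
  obtain ⟨y, hy⟩ := IsDedekindDomain.exists_sup_span_eq
    ((Ideal.span_singleton_le_iff_mem J).2 hxJ) (by simpa using hx0)
  have hJ' : J = Ideal.span {x, y} := by rw [← hy, Ideal.span_insert]
  obtain ⟨p, hp⟩ := hfix (x * σ x) (by rw [map_mul, hσ, mul_comm])
  obtain ⟨q, hq⟩ := hfix (y * σ y) (by rw [map_mul, hσ, mul_comm])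
  obtain ⟨r, hr⟩ := hfix (x * σ y + y * σ x) (by rw [map_add, map_mul, map_mul, hσ, hσ]; ring)
  obtain ⟨n, hn⟩ := (IsPrincipalIdealRing.principal (Ideal.span {p, q, r} : Ideal ℤ)).principal
  -- For `J = (x, y)`, `n` is the content of the norm form of `xX + yY`, namely `pX² + rXY + qY²`;
  -- the rest is Gauss's lemma.
  have hnp : n ∣ p := by
    rw [← Ideal.mem_span_singleton, ← Ideal.submodule_span_eq, ← hn]
    exact Ideal.subset_span (by simp)
  have hnq : n ∣ q := by
    rw [← Ideal.mem_span_singleton, ← Ideal.submodule_span_eq, ← hn]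
    exact Ideal.subset_span (by simp)
  have hnr : n ∣ r := by
    rw [← Ideal.mem_span_singleton, ← Ideal.submodule_span_eq, ← hn]
    exact Ideal.subset_span (by simp)
  have hn' : n ∈ (Ideal.span {p, q, r} : Ideal ℤ) := by
    rw [hn]
    exact Ideal.mem_span_singleton_self n
  rw [Ideal.mem_span_insert] at hn'
  obtain ⟨a, z, hz, hn'⟩ := hn'
  obtain ⟨b, c, rfl⟩ := Ideal.mem_span_pair.1 hz
  refine ⟨n, ?_⟩
  have hprod : J * J.map (σ : S →+* S) =
      Ideal.span {x * σ x, x * σ y, y * σ x, y * σ y} := by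
    rw [hJ', Ideal.map_span, Set.image_pair, Ideal.span_pair_mul_span_pair]
    rfl
  rw [hprod]
  apply le_antisymm
  · obtain ⟨p', hp'⟩ := hnp
    obtain ⟨q', hq'⟩ := hnq
    obtain ⟨r', hr'⟩ := hnr
    -- Its trace `r` is divisible by `n`, and its norm `pq` by `n²`.
    have hxz : (n : S) ∣ x * σ y := by
      refine dvd_of_sq_dvd_norm (FractionRing S) (z' := y * σ x) (a := r') (b := p' * q') ?_ ?_ ?_
      · rw [hr, hr']
        push_cast
        ring
      · have : x * σ y * (y * σ x) = (x * σ x) * (y * σ y) := by ring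
        rw [this, hp, hq, hp', hq']
        push_cast
        ring
      · intro h0
        exfalso
        rw [hp', Int.cast_mul, h0, zero_mul, mul_eq_zero] at hp
        rcases hp with hp | hp
        · exact hx0 hp
        · exact hx0 (by simpa using hp)
    rw [Ideal.span_le]
    rintro w (rfl | rfl | rfl | rfl)
    · rw [SetLike.mem_coe, Ideal.mem_span_singleton, hp, hp']
      exact ⟨p', by push_cast; ring⟩
    · rwa [SetLike.mem_coe, Ideal.mem_span_singleton]
    · rw [SetLike.mem_coe, Ideal.mem_span_singleton]
      have : y * σ x = (r : S) - x * σ y := by rw [← hr]; ring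
      rw [this]
      refine dvd_sub ⟨r', by rw [hr']; push_cast; ring⟩ hxz
    · rw [SetLike.mem_coe, Ideal.mem_span_singleton, hq, hq']
      exact ⟨q', by push_cast; ring⟩
  · rw [Ideal.span_singleton_le_iff_mem]
    have : (n : S) = a * (x * σ x) + (b * (y * σ y) + c * (x * σ y + y * σ x)) := by
      rw [hp, hq, hr, hn']
      push_cast
      ring
    rw [this]
    have m1 : x * σ x ∈ Ideal.span {x * σ x, x * σ y, y * σ x, y * σ y} :=
      Ideal.subset_span (by simp)
    have m2 : x * σ y ∈ Ideal.span {x * σ x, x * σ y, y * σ x, y * σ y} :=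
      Ideal.subset_span (by simp)
    have m3 : y * σ x ∈ Ideal.span {x * σ x, x * σ y, y * σ x, y * σ y} :=
      Ideal.subset_span (by simp)
    have m4 : y * σ y ∈ Ideal.span {x * σ x, x * σ y, y * σ x, y * σ y} :=
      Ideal.subset_span (by simp)
    exact add_mem (Ideal.mul_mem_left _ _ m1) (add_mem (Ideal.mul_mem_left _ _ m4)
      (Ideal.mul_mem_left _ _ (add_mem m2 m3)))

end Quadratic

/-- The properties of the extension of rings of integers used in the study of the capitulation
kernel. -/
structure CubicExtension {S R : Type*} [CommRing S] [CommRing R] [Algebra S R]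
    (σ : S ≃+* S) (g τ : R ≃+* R) (θ : R) : Prop where
  τ_τ_τ : ∀ x, τ (τ (τ x)) = x
  g_g : ∀ x, g (g x) = x
  g_τ : ∀ x, g (τ x) = τ (g x)
  τ_algebraMap : ∀ s : S, τ (algebraMap S R s) = algebraMap S R s
  g_algebraMap : ∀ s : S, g (algebraMap S R s) = algebraMap S R (σ s)
  fixed : ∀ x, τ x = x → ∃ s : S, algebraMap S R s = x
  injective : Function.Injective (algebraMap S R)
  map_injective : ∀ J J' : Ideal S, J.map (algebraMap S R) = J'.map (algebraMap S R) → J = J'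
  conj : ∀ J : Ideal S, ∃ n : ℤ, J * J.map (σ : S →+* S) = Ideal.span {(n : S)}
  trace_θ : θ + τ θ + τ (τ θ) = 0
  quad_θ : θ * τ θ + θ * τ (τ θ) + τ θ * τ (τ θ) = -3
  ramified : ∀ I : Ideal R, I ∣ Ideal.span {3 * θ ^ 2 - 3} → I.map (g : R →+* R) = I
  different_ne_zero : 3 * θ ^ 2 - 3 ≠ 0
  hilbert90 : ∀ v : Rˣ, (v : R) * τ v * τ (τ v) = 1 → ∃ α : R, α ≠ 0 ∧ α = v * τ α

/-! ### Capitulating ideals and units of relative norm 1. -/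

namespace CubicExtension

variable {S R : Type*} [CommRing S] [CommRing R] [Algebra S R]
    {σ : S ≃+* S} {g τ : R ≃+* R} {θ : R} (h : CubicExtension σ g τ θ)

include h

/-- Euler's formula: with `f = X³ - 3X + 1` and `f/(X-θ) = X² + θX + (θ²-3)`, the element `f'(θ)x`
is a combination of the traces of `x`, `θx` and `θ²x`, and these traces lie in `I ∩ S`. -/
theorem different_mul_le {I : Ideal R} (hI : ∀ x ∈ I, τ x ∈ I) :
    Ideal.span {3 * θ ^ 2 - 3} * I ≤ (I.comap (algebraMap S R)).map (algebraMap S R) := by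
  rw [Ideal.span_singleton_mul_le_iff]
  intro x hx
  have htr : ∀ y ∈ I, y + τ y + τ (τ y) ∈ (I.comap (algebraMap S R)).map (algebraMap S R) := by
    intro y hy
    obtain ⟨s, hs⟩ := h.fixed (y + τ y + τ (τ y)) (by
      rw [map_add, map_add, h.τ_τ_τ]; ring)
    rw [← hs]
    refine Ideal.mem_map_of_mem _ (Ideal.mem_comap.2 ?_)
    rw [hs]
    exact add_mem (add_mem hy (hI _ hy)) (hI _ (hI _ hy))
  have hid : (3 * θ ^ 2 - 3) * x = (θ ^ 2 - 3) * (x + τ x + τ (τ x)) +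
      θ * (θ * x + τ (θ * x) + τ (τ (θ * x))) +
      (θ ^ 2 * x + τ (θ ^ 2 * x) + τ (τ (θ ^ 2 * x))) := by
    have h1 := h.trace_θ
    have h2 := h.quad_θ
    simp only [map_mul, map_pow]
    generalize τ (τ θ) = c at *
    generalize τ θ = b at *
    linear_combination (-τ x * (θ + b) - τ (τ x) * (θ + c)) * h1 + (τ x + τ (τ x)) * h2
  rw [hid]
  exact add_mem (add_mem (Ideal.mul_mem_left _ _ (htr _ hx))
    (Ideal.mul_mem_left _ _ (htr _ (Ideal.mul_mem_left _ _ hx))))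
    (htr _ (Ideal.mul_mem_left _ _ hx))

omit h in
theorem map_span_singleton (f : R ≃+* R) (x : R) :
    (Ideal.span {x}).map (f : R →+* R) = Ideal.span {f x} := by
  rw [Ideal.map_span, Set.image_singleton]
  rfl

theorem map_τ_map (J : Ideal S) :
    (J.map (algebraMap S R)).map (τ : R →+* R) = J.map (algebraMap S R) := by
  rw [Ideal.map_map]
  congr 1
  ext s
  exact h.τ_algebraMap s

theorem map_g_map (J : Ideal S) :
    (J.map (algebraMap S R)).map (g : R →+* R) = (J.map (σ : S →+* S)).map (algebraMap S R) := by
  rw [Ideal.map_map, Ideal.map_map]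
  congr 1
  ext s
  exact h.g_algebraMap s

theorem norm_mul_eq_one [IsDomain R] {u : Rˣ} {α : R} (hα : α ≠ 0) (hu : α = u * τ α) :
    (u : R) * τ u * τ (τ u) = 1 := by
  have h1 : τ α = τ u * τ (τ α) := by conv_lhs => rw [hu, map_mul]
  have h2 : τ (τ α) = τ (τ u) * α := by conv_lhs => rw [h1, map_mul, h.τ_τ_τ]
  apply mul_right_cancel₀ hα
  rw [one_mul]
  conv_rhs => rw [hu, h1, h2]
  ring

variable [IsDedekindDomain R]

/-- An extended ideal is `τ`-stable, so `α/τα` is a unit `u`. Since `J` times its conjugate is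
`(n)`, one has `α·gα = n w` with `w` a unit, whence `u·gu = w/τw`. -/
theorem exists_unit_of_ideal {J : Ideal S} {α : R} (hα : α ≠ 0)
    (hJ : J.map (algebraMap S R) = Ideal.span {α}) :
    ∃ u : Rˣ, α = u * τ α ∧ ∃ w : Rˣ, (u : R) * g u * τ w = w := by
  have h1 : Ideal.span {α} = Ideal.span {τ α} := by
    have := h.map_τ_map J
    rw [hJ, map_span_singleton] at this
    exact this.symm
  obtain ⟨u, hu⟩ := (Ideal.span_singleton_eq_span_singleton.1 h1).symm
  have hu' : α = u * τ α := by rw [mul_comm]; exact hu.symm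
  refine ⟨u, hu', ?_⟩
  obtain ⟨n, hn⟩ := h.conj J
  have h2 := congrArg (Ideal.map (algebraMap S R)) hn
  rw [Ideal.map_mul, ← h.map_g_map, hJ, map_span_singleton, Ideal.map_span,
    Set.image_singleton, map_intCast, Ideal.span_singleton_mul_span_singleton] at h2
  obtain ⟨w, hw⟩ := (Ideal.span_singleton_eq_span_singleton.1 h2).symm
  have hw' : (n : R) * w = α * g α := hw
  refine ⟨w, ?_⟩
  have hn0 : (n : R) ≠ 0 := by
    intro h0
    rw [h0, zero_mul, eq_comm, mul_eq_zero] at hw'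
    rcases hw' with h3 | h3
    · exact hα h3
    · exact hα (by simpa using h3)
  have h3 := congrArg τ hw'
  rw [map_mul, map_mul, map_intCast, ← h.g_τ] at h3
  have h4 : g α = g u * g (τ α) := by conv_lhs => rw [hu', map_mul]
  apply mul_left_cancel₀ hn0
  linear_combination (u : R) * g u * h3 - hw' - g α * hu' - u * τ α * h4

variable [IsDedekindDomain S]

/-- The ideal found is the square of `(α) ∩ S`, where `v = α/τα`, and its generator is `β = nα/gα`,
for which `β/τβ = v/gv = v²`. -/
theorem exists_ideal_of_unit [CharZero S] {v : Rˣ} (hg : (v : R) * g v = 1)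
    (hN : (v : R) * τ v * τ (τ v) = 1) :
    ∃ (J : Ideal S) (β : R), J ≠ ⊥ ∧ β ≠ 0 ∧
      J.map (algebraMap S R) = Ideal.span {β} ∧ β = v ^ 2 * τ β := by
  obtain ⟨α, hα, hv⟩ := h.hilbert90 v hN
  set I : Ideal R := Ideal.span {α} with hI
  have hI0 : I ≠ ⊥ := by simpa [hI] using hα
  set J := I.comap (algebraMap S R) with hJ
  have hle : J.map (algebraMap S R) ≤ I := Ideal.map_comap_le
  have hdiff : Ideal.span {3 * θ ^ 2 - 3} * I ≤ J.map (algebraMap S R) := by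
    apply h.different_mul_le
    intro x hx
    rw [hI, Ideal.mem_span_singleton] at hx ⊢
    obtain ⟨y, rfl⟩ := hx
    refine ⟨((v⁻¹ : Rˣ) : R) * τ y, ?_⟩
    rw [map_mul]
    conv_rhs => rw [hv]
    have := v.mul_inv
    linear_combination (-τ α * τ y) * this
  -- `𝔠` measures how far `(α)` is from being extended from `S`; it divides `f'(θ)`, hence is
  -- `g`-invariant.
  obtain ⟨𝔠, h𝔠⟩ := Ideal.dvd_iff_le.2 hle
  have h𝔠g : 𝔠.map (g : R →+* R) = 𝔠 := by
    apply h.ramified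
    have := Ideal.dvd_iff_le.2 hdiff
    rw [h𝔠, mul_comm _ I] at this
    exact (mul_dvd_mul_iff_left hI0).1 this
  have hJ0 : J ≠ ⊥ := by
    intro h0
    rw [h0, Ideal.map_bot, le_bot_iff, Ideal.mul_eq_bot] at hdiff
    rcases hdiff with h1 | h1
    · exact h.different_ne_zero (by simpa using h1)
    · exact hI0 h1
  obtain ⟨n, hn⟩ := h.conj J
  have hn0 : n ≠ 0 := by
    rintro rfl
    rw [Int.cast_zero, Ideal.span_singleton_eq_bot.2 rfl, Ideal.mul_eq_bot] at hn
    rcases hn with hn | hn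
    · exact hJ0 hn
    · rw [Ideal.map_eq_bot_iff_of_injective (f := (σ : S →+* S)) σ.injective] at hn
      exact hJ0 hn
  have hnR : (n : R) ≠ 0 := by
    have : algebraMap S R (n : S) ≠ 0 := fun h0 =>
      hn0 (by exact_mod_cast h.injective (h0.trans (map_zero _).symm))
    simpa using this
  have hgα : g α ≠ 0 := by simpa using hα
  -- The factor `𝔠` cancels between `J = I𝔠` and its conjugate `g(I)𝔠`, and `J` times its conjugate
  -- is `(n)`.
  have key : (J * J).map (algebraMap S R) * Ideal.span {g α} = Ideal.span {(n : R) * α} := by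
    have h1 : (J.map (σ : S →+* S)).map (algebraMap S R) = Ideal.span {g α} * 𝔠 := by
      rw [← h.map_g_map, h𝔠, Ideal.map_mul, h𝔠g, hI, map_span_singleton]
    have h2 : J.map (algebraMap S R) * Ideal.span {g α} =
        (J.map (σ : S →+* S)).map (algebraMap S R) * I := by
      rw [h1, h𝔠]
      ring
    rw [Ideal.map_mul, mul_assoc, h2, ← mul_assoc, ← Ideal.map_mul, hn, Ideal.map_span,
      Set.image_singleton, map_intCast, hI, Ideal.span_singleton_mul_span_singleton]
  have hdvd : g α ∣ (n : R) * α := by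
    rw [← Ideal.span_singleton_le_span_singleton, ← key]
    exact Ideal.dvd_iff_le.1 (dvd_mul_left _ _)
  obtain ⟨β, hβ⟩ := hdvd
  have hJJ : J * J ≠ ⊥ := mul_ne_zero hJ0 hJ0
  clear_value J
  refine ⟨J * J, β, hJJ, ?_, ?_, ?_⟩
  · rintro rfl
    rw [mul_zero, mul_eq_zero] at hβ
    exact hβ.elim hnR hα
  · have hne : Ideal.span {g α} ≠ 0 := by simpa using hgα
    apply mul_left_cancel₀ hne
    rw [mul_comm, key, hβ, Ideal.span_singleton_mul_span_singleton]
  · have e1 := congrArg τ hβ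
    rw [map_mul, map_mul, map_intCast, ← h.g_τ] at e1
    have e2 : g α = g v * g (τ α) := by conv_lhs => rw [hv, map_mul]
    have hne : g (τ α) ≠ 0 := by simpa using hα
    apply mul_left_cancel₀ hne
    have e3 : g (τ α) = v * g α := by
      rw [e2, ← mul_assoc, hg, one_mul]
    rw [e3]
    rw [e3] at e1
    linear_combination -(v : R) * hβ + (n : R) * v * hv + (v : R) ^ 2 * e1

-- The hypothesis says that `α₁/(α₂w)` is fixed by `τ`, so the two extended ideals differ by an
-- element of the fraction field of `S`.
open nonZeroDivisors in
theorem mk0_eq_of_cobound {J₁ J₂ : (Ideal S)⁰} {α₁ α₂ : R} (h1 : α₁ ≠ 0) (h2 : α₂ ≠ 0)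
    (hJ₁ : (J₁ : Ideal S).map (algebraMap S R) = Ideal.span {α₁})
    (hJ₂ : (J₂ : Ideal S).map (algebraMap S R) = Ideal.span {α₂}) {w : Rˣ}
    (hw : α₁ * τ α₂ * τ w = τ α₁ * α₂ * w) :
    ClassGroup.mk0 J₁ = ClassGroup.mk0 J₂ := by
  -- Multiplying by `r` turns `α₂w` into its norm, so the fixed quotient becomes a ratio of two
  -- elements of `S`.
  set r : R := τ (α₂ * w) * τ (τ (α₂ * w)) with hr
  have hαw : α₂ * w ≠ 0 := mul_ne_zero h2 w.ne_zero
  have hr0 : r ≠ 0 := by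
    rw [hr]
    exact mul_ne_zero (by simpa using h2) (by simpa using h2)
  obtain ⟨s, hs⟩ := h.fixed (α₂ * w * r) (by
    simp only [hr, map_mul, h.τ_τ_τ]; ring)
  obtain ⟨a, ha⟩ := h.fixed (α₁ * r) (by
    simp only [hr, map_mul, h.τ_τ_τ]
    linear_combination (-(τ (τ α₂) * τ (τ w))) * hw)
  rw [ClassGroup.mk0_eq_mk0_iff]
  refine ⟨s, a, ?_, ?_, ?_⟩
  · rintro rfl
    rw [map_zero] at hs
    exact mul_ne_zero hαw hr0 hs.symm
  · rintro rfl
    rw [map_zero] at ha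
    exact mul_ne_zero h1 hr0 ha.symm
  · apply h.map_injective
    rw [Ideal.map_mul, Ideal.map_mul, Ideal.map_span, Ideal.map_span, Set.image_singleton,
      Set.image_singleton, hs, ha, hJ₁, hJ₂, Ideal.span_singleton_mul_span_singleton,
      Ideal.span_singleton_mul_span_singleton]
    rw [Ideal.span_singleton_eq_span_singleton]
    exact ⟨w⁻¹, by
      have := w.mul_inv
      linear_combination (α₂ * r * α₁) * this⟩

end CubicExtension

end KummerUnits

namespace KummerUnits

open nonZeroDivisors

/-- The action of a ring automorphism on units. -/
def unitsAut {R : Type*} [CommRing R] (τ : R ≃+* R) : Rˣ →* Rˣ := Units.map (τ : R →* R)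

@[simp]
theorem coe_unitsAut {R : Type*} [CommRing R] (τ : R ≃+* R) (u : Rˣ) :
    (unitsAut τ u : R) = τ u := rfl

/-- The units of the form `w / τ w`. -/
def coboundaries {R : Type*} [CommRing R] (τ : R ≃+* R) : Subgroup Rˣ :=
  (MonoidHom.id Rˣ / unitsAut τ).range

theorem mem_coboundaries {R : Type*} [CommRing R] {τ : R ≃+* R} {u : Rˣ} :
    u ∈ coboundaries τ ↔ ∃ w : Rˣ, u = w / unitsAut τ w := by
  constructor
  · rintro ⟨w, rfl⟩
    exact ⟨w, rfl⟩
  · rintro ⟨w, rfl⟩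
    exact ⟨w, rfl⟩

/-! ### The order of the capitulation kernel. -/

namespace CubicExtension

variable {S R : Type*} [CommRing S] [CommRing R] [Algebra S R]
    {σ : S ≃+* S} {g τ : R ≃+* R} {θ : R} (h : CubicExtension σ g τ θ)

/-- The witness `u²·τu` is the multiplicative form of `3 = N + (1-τ)(2+τ)`. -/
theorem pow_three_mem_coboundaries {u : Rˣ}
    (hu : u * unitsAut τ u * unitsAut τ (unitsAut τ u) = 1) : u ^ 3 ∈ coboundaries τ := by
  rw [mem_coboundaries]
  refine ⟨u * u * unitsAut τ u, ?_⟩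
  rw [eq_div_iff_mul_eq', map_mul, map_mul, mul_comm]
  calc unitsAut τ u * unitsAut τ u * unitsAut τ (unitsAut τ u) * u ^ 3
      = (u * unitsAut τ u * unitsAut τ (unitsAut τ u)) * (u * u * unitsAut τ u) := by
        rw [pow_succ, pow_two]
        ac_rfl
    _ = u * u * unitsAut τ u := by rw [hu, one_mul]

include h

theorem unitsAut_g_g (u : Rˣ) : unitsAut g (unitsAut g u) = u :=
  Units.ext (h.g_g u)

theorem unitsAut_g_τ (u : Rˣ) : unitsAut g (unitsAut τ u) = unitsAut τ (unitsAut g u) :=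
  Units.ext (h.g_τ u)

variable [IsDedekindDomain R]

/-- Take `v = u/gu`. Modulo coboundaries `gu` is `u⁻¹` and `u³` is 1, so `v` represents `u² = u⁻¹`.
-/
theorem exists_norm_one_unit {J : Ideal S} {α : R} (hα : α ≠ 0)
    (hJ : J.map (algebraMap S R) = Ideal.span {α}) :
    ∃ u v : Rˣ, α = u * τ α ∧ v * unitsAut g v = 1 ∧
      v * unitsAut τ v * unitsAut τ (unitsAut τ v) = 1 ∧ u * v ∈ coboundaries τ := by
  obtain ⟨u, hu, w, hw⟩ := h.exists_unit_of_ideal hα hJ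
  have hN : u * unitsAut τ u * unitsAut τ (unitsAut τ u) = 1 :=
    Units.ext (h.norm_mul_eq_one hα hu)
  refine ⟨u, u / unitsAut g u, hu, ?_, ?_, ?_⟩
  · rw [map_div, h.unitsAut_g_g, div_mul_div_cancel, div_self']
  · rw [map_div, map_div, ← h.unitsAut_g_τ, ← h.unitsAut_g_τ, div_mul_div_comm, div_mul_div_comm,
      ← map_mul, ← map_mul, hN, map_one, div_one]
  · have h1 : u * unitsAut g u ∈ coboundaries τ := by
      rw [mem_coboundaries]
      refine ⟨w, eq_div_iff_mul_eq'.2 (Units.ext ?_)⟩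
      rw [Units.val_mul, Units.val_mul]
      exact hw
    have h2 : u * (u / unitsAut g u) = u ^ 3 / (u * unitsAut g u) := by
      apply Additive.ofMul.injective
      simp only [ofMul_mul, ofMul_div, ofMul_pow]
      module
    rw [h2]
    exact div_mem (pow_three_mem_coboundaries hN) h1

variable [IsDedekindDomain S]

theorem mk0_eq_of_div_mem {J₁ J₂ : (Ideal S)⁰} {α₁ α₂ : R} (h1 : α₁ ≠ 0) (h2 : α₂ ≠ 0)
    (hJ₁ : (J₁ : Ideal S).map (algebraMap S R) = Ideal.span {α₁})
    (hJ₂ : (J₂ : Ideal S).map (algebraMap S R) = Ideal.span {α₂}) {u₁ u₂ : Rˣ}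
    (hu₁ : α₁ = u₁ * τ α₁) (hu₂ : α₂ = u₂ * τ α₂) (hu : u₁ / u₂ ∈ coboundaries τ) :
    ClassGroup.mk0 J₁ = ClassGroup.mk0 J₂ := by
  obtain ⟨w, hw⟩ := mem_coboundaries.1 hu
  rw [div_eq_div_iff_mul_eq_mul] at hw
  have hw' : (u₁ : R) * τ w = w * u₂ := congrArg Units.val hw
  refine h.mk0_eq_of_cobound h1 h2 hJ₁ hJ₂ (w := w) ?_
  linear_combination (τ α₂ * τ w) * hu₁ - (τ α₁ * w) * hu₂ + τ α₁ * τ α₂ * hw'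

theorem mk0_eq_one_of_mem {J : (Ideal S)⁰} {α : R} (hα : α ≠ 0)
    (hJ : (J : Ideal S).map (algebraMap S R) = Ideal.span {α}) {u : Rˣ}
    (hu : α = u * τ α) (huT : u ∈ coboundaries τ) : ClassGroup.mk0 J = 1 := by
  rw [← map_one (ClassGroup.mk0 : (Ideal S)⁰ →* ClassGroup S)]
  refine h.mk0_eq_of_div_mem (α₂ := 1) (u₂ := 1) hα one_ne_zero hJ ?_ hu (by simp) (by simpa)
  rw [OneMemClass.coe_one, Ideal.one_eq_top, Ideal.map_top, Ideal.span_singleton_one]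

theorem mem_coboundaries_of_mk0_eq_one {J : (Ideal S)⁰} {α : R} (hα : α ≠ 0)
    (hJ : (J : Ideal S).map (algebraMap S R) = Ideal.span {α}) {u : Rˣ}
    (hu : α = u * τ α) (h1 : ClassGroup.mk0 J = 1) : u ∈ coboundaries τ := by
  rw [ClassGroup.mk0_eq_one_iff J.2] at h1
  obtain ⟨γ, hγ⟩ := h1.principal
  have hγ' : (J : Ideal S) = Ideal.span {γ} := hγ
  rw [hγ', Ideal.map_span, Set.image_singleton] at hJ
  obtain ⟨w, hw⟩ := Ideal.span_singleton_eq_span_singleton.1 hJ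
  have hγ0 : algebraMap S R γ ≠ 0 := by
    intro h0
    rw [h0, zero_mul] at hw
    exact hα hw.symm
  rw [mem_coboundaries]
  refine ⟨w, eq_div_iff_mul_eq'.2 (Units.ext (mul_left_cancel₀ hγ0 ?_))⟩
  rw [← hw, map_mul, h.τ_algebraMap] at hu
  rw [Units.val_mul, coe_unitsAut, hu]
  ring

variable [Module.IsTorsionFree S R]

omit h in
theorem exists_generator_of_mem_ker {c : ClassGroup S}
    (hc : c ∈ (ClassGroup.extendedHom S R).ker) :
    ∃ (J : (Ideal S)⁰) (α : R), ClassGroup.mk0 J = c ∧ α ≠ 0 ∧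
      (J : Ideal S).map (algebraMap S R) = Ideal.span {α} := by
  obtain ⟨J, rfl⟩ := ClassGroup.mk0_surjective c
  rw [MonoidHom.mem_ker, ClassGroup.extendedHom_mk0,
    ClassGroup.mk0_eq_one_iff (ClassGroup.extendedIdeal S R J).2] at hc
  obtain ⟨α, hα⟩ := hc.principal
  refine ⟨J, α, rfl, ?_, hα⟩
  rintro rfl
  apply nonZeroDivisors.ne_zero (ClassGroup.extendedIdeal S R J).2
  rw [hα]
  simp

omit h in
theorem mk0_mem_ker {J : (Ideal S)⁰} {α : R}
    (hJ : (J : Ideal S).map (algebraMap S R) = Ideal.span {α}) :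
    ClassGroup.mk0 J ∈ (ClassGroup.extendedHom S R).ker := by
  rw [MonoidHom.mem_ker, ClassGroup.extendedHom_mk0,
    ClassGroup.mk0_eq_one_iff (ClassGroup.extendedIdeal S R J).2]
  exact ⟨α, hJ⟩

/-- If every unit of relative norm `1` to both subfields is of the form `w / τ w`, then no ideal
class capitulates. -/
theorem extendedHom_injective
    (hL : ∀ v : Rˣ, v * unitsAut g v = 1 →
      v * unitsAut τ v * unitsAut τ (unitsAut τ v) = 1 → v ∈ coboundaries τ) :
    Function.Injective (ClassGroup.extendedHom S R) := by
  rw [injective_iff_map_eq_one]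
  intro c hc
  obtain ⟨J, α, rfl, hα, hJ⟩ := exists_generator_of_mem_ker (MonoidHom.mem_ker.2 hc)
  obtain ⟨u, v, hu, hgv, hNv, huv⟩ := h.exists_norm_one_unit hα hJ
  exact h.mk0_eq_one_of_mem hα hJ hu (((coboundaries τ).mul_mem_cancel_right (hL v hgv hNv)).1 huv)

/-- If the units of relative norm `1` to both subfields are, modulo those of the form `w / τ w`,
generated by one unit which is not of that form, then the capitulation kernel has order `3`. -/
theorem card_ker_extendedHom [CharZero S] {l : Rˣ} (hgl : l * unitsAut g l = 1)
    (hNl : l * unitsAut τ l * unitsAut τ (unitsAut τ l) = 1) (hl : l ∉ coboundaries τ)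
    (hL : ∀ v : Rˣ, v * unitsAut g v = 1 →
      v * unitsAut τ v * unitsAut τ (unitsAut τ v) = 1 →
      ∃ k : ℤ, v / l ^ k ∈ coboundaries τ) :
    Nat.card (ClassGroup.extendedHom S R).ker = 3 := by
  obtain ⟨J, β, hJ0, hβ0, hJ, hβ⟩ := h.exists_ideal_of_unit
    (congrArg Units.val hgl) (congrArg Units.val hNl)
  have hl3 : l ^ 3 ∈ coboundaries τ := pow_three_mem_coboundaries hNl
  obtain ⟨J₀, rfl⟩ : ∃ J₀ : (Ideal S)⁰, (J₀ : Ideal S) = J :=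
    ⟨⟨J, mem_nonZeroDivisors_iff_ne_zero.2 hJ0⟩, rfl⟩
  have hJm : ∀ m : ℕ, ((J₀ ^ m : (Ideal S)⁰) : Ideal S).map (algebraMap S R) =
      Ideal.span {β ^ m} := by
    intro m
    rw [SubmonoidClass.coe_pow, Ideal.map_pow, hJ, Ideal.span_singleton_pow]
  have hβm : ∀ m : ℕ, β ^ m = ((l ^ (2 * m) : Rˣ) : R) * τ (β ^ m) := by
    intro m
    conv_lhs => rw [hβ]
    rw [map_pow, mul_pow, Units.val_pow_eq_pow_val, pow_mul]
  have h1 : ClassGroup.mk0 J₀ ≠ 1 := by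
    intro h1
    have h2 := h.mem_coboundaries_of_mk0_eq_one hβ0 hJ (u := l ^ 2) (by simpa using hβ) h1
    apply hl
    have : l = l ^ 3 / l ^ 2 := by rw [eq_div_iff_mul_eq', ← pow_succ']
    rw [this]
    exact div_mem hl3 h2
  have h3 : ClassGroup.mk0 J₀ ^ 3 = 1 := by
    rw [← map_pow]
    refine h.mk0_eq_one_of_mem (pow_ne_zero 3 hβ0) (hJm 3) (hβm 3) ?_
    rw [mul_comm, pow_mul]
    exact pow_mem hl3 2
  have hker : (ClassGroup.extendedHom S R).ker = Subgroup.zpowers (ClassGroup.mk0 J₀) := by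
    apply le_antisymm
    · intro c hc
      obtain ⟨I, α, rfl, hα, hI⟩ := exists_generator_of_mem_ker hc
      obtain ⟨u, v, hu, hgv, hNv, huv⟩ := h.exists_norm_one_unit hα hI
      obtain ⟨k, hk⟩ := hL v hgv hNv
      obtain ⟨m, q, hm⟩ : ∃ (m : ℕ) (q : ℤ), k = 3 * q + m :=
        ⟨(k % 3).toNat, k / 3, by omega⟩
      have : ClassGroup.mk0 I = ClassGroup.mk0 (J₀ ^ m) := by
        refine h.mk0_eq_of_div_mem hα (pow_ne_zero m hβ0) hI (hJm m) hu (hβm m) ?_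
        -- Modulo coboundaries `u` is `v⁻¹`, hence `l⁻ᵏ`, which equals `l²ᵐ` because cubes are
        -- trivial and `k ≡ m` modulo 3.
        have he : u / l ^ (2 * m) = (u * v) / (v / l ^ k) / (l ^ 3) ^ (q + m) := by
          rw [hm]
          apply Additive.ofMul.injective
          simp only [ofMul_mul, ofMul_div, ofMul_pow, ofMul_zpow]
          module
        rw [he]
        exact div_mem (div_mem huv hk) (zpow_mem hl3 _)
      rw [this, map_pow]
      exact pow_mem (Subgroup.mem_zpowers _) m
    · rw [Subgroup.zpowers_le]
      exact mk0_mem_ker hJ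
  rw [hker, Nat.card_zpowers]
  exact orderOf_eq_prime h3 h1

end CubicExtension

end KummerUnits

namespace KummerUnits

/-! ### Fixed elements, norms and Hilbert 90 in cyclic extensions. -/

section CyclicGalois

variable {F K : Type*} [Field F] [Field K] [Algebra F K] [FiniteDimensional F K] [IsGalois F K]
  {τ : K ≃ₐ[F] K}

theorem pow_finrank_eq_one : τ ^ Module.finrank F K = 1 := by
  rw [← IsGalois.card_aut_eq_finrank F K]
  exact pow_card_eq_one'

theorem exists_algebraMap_eq_of_fixed (hτ : Subgroup.zpowers τ = ⊤) {x : K} (hx : τ x = x) :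
    ∃ y : F, algebraMap F K y = x := by
  refine (IsGalois.mem_range_algebraMap_iff_fixed x).2 fun f => ?_
  have hf : f ∈ Subgroup.zpowers τ := hτ ▸ Subgroup.mem_top f
  have hle : Subgroup.zpowers τ ≤ MulAction.stabilizer (K ≃ₐ[F] K) x :=
    (Subgroup.zpowers_le).2 hx
  exact hle hf

theorem norm_eq_of_finrank_eq_three (hτ : Subgroup.zpowers τ = ⊤)
    (h3 : Module.finrank F K = 3) (x : K) :
    algebraMap F K (Algebra.norm F x) = x * τ x * τ (τ x) := by
  classical
  have hmem : ∀ f, f ∈ Subgroup.zpowers τ := fun f => hτ ▸ Subgroup.mem_top f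
  have hord : orderOf τ = 3 := by
    rw [orderOf_eq_card_of_forall_mem_zpowers hmem, IsGalois.card_aut_eq_finrank, h3]
  rw [Algebra.norm_eq_prod_automorphisms, ← IsCyclic.image_range_orderOf hmem, hord,
    Finset.prod_image]
  · rw [Finset.prod_range_succ, Finset.prod_range_succ, Finset.prod_range_one]
    rfl
  · intro i hi j hj hij
    rw [← hord] at hi hj
    exact pow_injOn_Iio_orderOf (by simpa using hi) (by simpa using hj) hij

end CyclicGalois

section Integers

variable {F K : Type*} [Field F] [Field K] [Algebra F K] [FiniteDimensional F K] [IsGalois F K]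
  {τ : K ≃ₐ[F] K}

theorem exists_integer_of_fixed (hτ : Subgroup.zpowers τ = ⊤) {x : 𝓞 K} (hx : τ (x : K) = x) :
    ∃ y : 𝓞 F, algebraMap (𝓞 F) (𝓞 K) y = x := by
  obtain ⟨y, hy⟩ := exists_algebraMap_eq_of_fixed hτ hx
  have hintegral : IsIntegral ℤ y := by
    rw [← isIntegral_algebraMap_iff (algebraMap F K).injective, hy]
    exact x.2
  exact ⟨⟨y, hintegral⟩, RingOfIntegers.ext hy⟩

theorem exists_unit_of_fixed (hτ : Subgroup.zpowers τ = ⊤) {u : (𝓞 K)ˣ}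
    (hu : τ ((u : 𝓞 K) : K) = ((u : 𝓞 K) : K)) :
    ∃ w : (𝓞 F)ˣ, Units.map (algebraMap (𝓞 F) (𝓞 K)).toMonoidHom w = u := by
  have hu' : τ (((u⁻¹ : (𝓞 K)ˣ) : 𝓞 K) : K) = (((u⁻¹ : (𝓞 K)ˣ) : 𝓞 K) : K) := by
    have h1 : ((u : 𝓞 K) : K) * (((u⁻¹ : (𝓞 K)ˣ) : 𝓞 K) : K) = 1 := by
      rw [← map_mul, Units.mul_inv, map_one]
    have h2 := congrArg τ h1
    rw [map_mul, hu, map_one, ← h1] at h2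
    exact mul_left_cancel₀ (left_ne_zero_of_mul_eq_one h1) h2
  obtain ⟨y, hy⟩ := exists_integer_of_fixed hτ hu
  obtain ⟨z, hz⟩ := exists_integer_of_fixed hτ hu'
  have hinj : Function.Injective (algebraMap (𝓞 F) (𝓞 K)) := by
    intro a b hab
    apply RingOfIntegers.ext
    exact (algebraMap F K).injective (congrArg (fun t : 𝓞 K => (t : K)) hab)
  have hyz : y * z = 1 := by
    apply hinj
    rw [map_mul, hy, hz, map_one, Units.mul_inv]
  exact ⟨⟨y, z, hyz, by rw [mul_comm, hyz]⟩, Units.ext hy⟩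

end Integers

theorem exists_cobound_of_norm_eq_one {F K : Type} [Field F] [NumberField F]
    [Field K] [NumberField K] [Algebra F K] [IsGalois F K] {τ : K ≃ₐ[F] K}
    (hτ : Subgroup.zpowers τ = ⊤) (h3 : Module.finrank F K = 3) {v : 𝓞 K}
    (hv : (v : K) * τ v * τ (τ v) = 1) :
    ∃ α : 𝓞 K, α ≠ 0 ∧ (α : K) = v * τ α := by
  have hmem : ∀ f, f ∈ Subgroup.zpowers τ := fun f => hτ ▸ Subgroup.mem_top f
  have : IsCyclic (K ≃ₐ[F] K) := ⟨τ, hmem⟩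
  have hnorm : Algebra.norm F (algebraMap (𝓞 K) K v) = 1 := by
    apply (algebraMap F K).injective
    rw [norm_eq_of_finrank_eq_three hτ h3, map_one]
    exact hv
  obtain ⟨ε, hε0, hε⟩ := groupCohomology.exists_mul_galRestrict_of_norm_eq_one
    (A := 𝓞 F) (K := F) (L := K) (B := 𝓞 K) hmem hnorm
  refine ⟨ε, hε0, ?_⟩
  have := congrArg (algebraMap (𝓞 K) K) hε
  rw [map_mul, algebraMap_galRestrict_apply] at this
  exact this.symm

/-! ### Units modulo cubes and the unit rank. -/

section ModNMap

variable {A B : Type*} [AddCommGroup A] [AddCommGroup B]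

/-- The map on `ModN · 3` induced by a homomorphism. -/
def modThreeMap (f : A →+ B) : ModN A 3 →ₗ[ZMod 3] ModN B 3 :=
  ModN.liftEquiv'.symm ⟨(ModN.mkQ 3).comp f, fun x => by
    rw [← map_nsmul, AddMonoidHom.comp_apply, map_nsmul]
    exact mkQ_eq_zero_iff.2 ⟨f x, (natCast_zsmul _ 3).symm⟩⟩

theorem modThreeMap_mkQ (f : A →+ B) (x : A) :
    modThreeMap f (ModN.mkQ 3 x) = ModN.mkQ 3 (f x) := rfl

theorem modThreeMap_injective {f : A →+ B}
    (hf : ∀ x y, f x = (3 : ℤ) • y → ∃ z, x = (3 : ℤ) • z) :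
    Function.Injective (modThreeMap f) := by
  rw [← LinearMap.ker_eq_bot, LinearMap.ker_eq_bot']
  intro m hm
  obtain ⟨x, rfl⟩ := mkQ_surjective m
  rw [modThreeMap_mkQ, mkQ_eq_zero_iff] at hm
  obtain ⟨y, hy⟩ := hm
  exact mkQ_eq_zero_iff.2 (hf x y hy)

theorem finrank_modThree_eq_of_surjective {f : A →+ B} (hs : Function.Surjective f)
    (hk : ∀ x, f x = 0 → ∃ z, x = (3 : ℤ) • z) :
    Module.finrank (ZMod 3) (ModN A 3) = Module.finrank (ZMod 3) (ModN B 3) := by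
  refine (LinearEquiv.ofBijective (modThreeMap f) ⟨modThreeMap_injective ?_, ?_⟩).finrank_eq
  · intro x y hxy
    obtain ⟨y, rfl⟩ := hs y
    obtain ⟨z, hz⟩ := hk (x - (3 : ℤ) • y) (by rw [map_sub, hxy, map_zsmul, sub_self])
    exact ⟨y + z, by rw [smul_add, ← hz]; abel⟩
  · intro m
    obtain ⟨y, rfl⟩ := mkQ_surjective m
    obtain ⟨x, rfl⟩ := hs y
    exact ⟨ModN.mkQ 3 x, rfl⟩

theorem finrank_modThree_of_free [Module.Free ℤ B] [Module.Finite ℤ B] :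
    Module.finrank (ZMod 3) (ModN B 3) = Module.finrank ℤ B := by
  rw [Module.finrank_eq_card_basis (ModN.basis (n := 3) (Module.Free.chooseBasis ℤ B)),
    Module.finrank_eq_card_chooseBasisIndex]

end ModNMap

/-- A unit of finite order of a field embedded in `ℝ` is `± 1`. -/
theorem eq_one_or_eq_neg_one_of_pow {K : Type*} [Field K] (φ : K →+* ℝ) {u : (𝓞 K)ˣ} {n : ℕ}
    (hn : n ≠ 0) (hu : u ^ n = 1) : u = 1 ∨ u = -1 := by
  have h1 : φ ((u : 𝓞 K) : K) ^ n = 1 := by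
    have := congrArg (fun t : (𝓞 K)ˣ => φ ((t : 𝓞 K) : K)) hu
    simpa using this
  have h2 : |φ ((u : 𝓞 K) : K)| = 1 := by
    rw [← abs_pow_eq_one _ hn, h1]
    simp
  rcases eq_or_eq_neg_of_abs_eq h2 with h3 | h3
  · left
    apply Units.ext
    apply RingOfIntegers.ext
    exact φ.injective (by simpa using h3)
  · right
    apply Units.ext
    apply RingOfIntegers.ext
    exact φ.injective (by simpa using h3)

/-- In a field with a real embedding the torsion units are `±1`, which are cubes, so the dimension
is that of the torsion-free quotient modulo 3. -/
theorem finrank_unitsModCubes {K : Type*} [Field K] [NumberField K] (φ : K →+* ℝ) :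
    Module.finrank (ZMod 3) (UnitsModCubes K) = Units.rank K := by
  rw [← Units.finrank_eq,
    ← finrank_quotient_eq_of_le_torsion (le_refl (Submodule.torsion ℤ (Additive (𝓞 K)ˣ))),
    ← finrank_modThree_of_free]
  refine finrank_modThree_eq_of_surjective
    (f := (Submodule.torsion ℤ (Additive (𝓞 K)ˣ)).mkQ.toAddMonoidHom)
    (Submodule.mkQ_surjective _) ?_
  · intro x hx
    obtain ⟨n, hn⟩ := (Submodule.Quotient.mk_eq_zero _).1 hx
    have hn0 : (n : ℤ) ≠ 0 := nonZeroDivisors.ne_zero n.2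
    have hx' : x.toMul ^ (n : ℤ).natAbs = 1 := by
      rw [pow_natAbs_eq_one]
      exact congrArg Additive.toMul hn
    refine ⟨x, ?_⟩
    apply Additive.toMul.injective
    rw [toMul_zsmul]
    rcases eq_one_or_eq_neg_one_of_pow φ (Int.natAbs_ne_zero.2 hn0) hx' with h1 | h1
    · rw [h1]
      simp
    · rw [h1]
      apply Units.ext
      norm_num

theorem units_rank_eq_of_isTotallyReal {K : Type*} [Field K] [NumberField K] [IsTotallyReal K] :
    Units.rank K = Module.finrank ℚ K - 1 := by
  rw [Units.rank, InfinitePlace.card_eq_nrRealPlaces_add_nrComplexPlaces,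
    IsTotallyReal.nrComplexPlaces_eq_zero, IsTotallyReal.finrank, add_zero]

end KummerUnits

namespace KummerUnits

/-! ### Degrees, normality and total reality of the fields. -/

open Polynomial IntermediateField

/-- `√(3d)` as an element of `K₁`. -/
noncomputable def sqrtElt (d : ℕ) : K₁ d :=
  ⟨√(3 * (d : ℝ)), (le_sup_left : quadField d ≤ K₁ d) (mem_adjoin_simple_self ℚ _)⟩

/-- `2 cos (2π/9)` as an element of `K₁`. -/
noncomputable def cosElt (d : ℕ) : K₁ d :=
  ⟨2 * Real.cos (2 * Real.pi / 9),
    (le_sup_right : cubicField ≤ K₁ d) (mem_adjoin_simple_self ℚ _)⟩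

theorem sqrt_sq (d : ℕ) : √(3 * (d : ℝ)) ^ 2 = 3 * d :=
  Real.sq_sqrt (by positivity)

theorem cos_cubic : (2 * Real.cos (2 * Real.pi / 9)) ^ 3 - 3 * (2 * Real.cos (2 * Real.pi / 9)) + 1
    = 0 := by
  have h := Real.cos_three_mul (2 * Real.pi / 9)
  have h2 : Real.cos (3 * (2 * Real.pi / 9)) = -(1 / 2) := by
    rw [show 3 * (2 * Real.pi / 9) = Real.pi - Real.pi / 3 by ring, Real.cos_pi_sub,
      Real.cos_pi_div_three]
  rw [h2] at h
  linear_combination -2 * h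

theorem sqrtElt_sq (d : ℕ) : sqrtElt d ^ 2 = 3 * (d : K₁ d) := by
  apply Subtype.ext
  have := sqrt_sq d
  push_cast
  exact this

theorem cosElt_cubic (d : ℕ) : cosElt d ^ 3 - 3 * cosElt d + 1 = 0 := by
  apply Subtype.ext
  have := cos_cubic
  push_cast
  exact this

/-- Rational numbers which are roots of a monic integral polynomial are integers. -/
theorem exists_int_of_isIntegral {q : ℚ} (h : IsIntegral ℤ q) : ∃ n : ℤ, (n : ℚ) = q :=
  IsIntegrallyClosed.isIntegral_iff.1 h

theorem finrank_quadField {d : ℕ} (hd : ¬ 3 ∣ d) : Module.finrank ℚ (quadField d) = 2 := by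
  set p : ℚ[X] := X ^ 2 - C (3 * (d : ℚ)) with hp
  have hmonic : p.Monic := by rw [hp]; monicity!
  have hdeg : p.natDegree = 2 := by rw [hp]; compute_degree!
  have hroot : aeval (√(3 * (d : ℝ))) p = 0 := by
    simp only [hp, map_sub, map_pow, aeval_X, aeval_C, sqrt_sq]
    simp
  have hirr : Irreducible p := by
    rw [hmonic.irreducible_iff_roots_eq_zero_of_degree_le_three (by omega) (by omega),
      Multiset.eq_zero_iff_forall_notMem]
    intro q hq
    have hq' : q ^ 2 - 3 * (d : ℚ) = 0 := by
      have := (mem_roots'.1 hq).2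
      simpa [hp, IsRoot.def] using this
    obtain ⟨n, rfl⟩ := exists_int_of_isIntegral (q := q)
      ⟨X ^ 2 - C (3 * (d : ℤ)), by monicity!, by simpa using hq'⟩
    have hn : n ^ 2 = 3 * (d : ℤ) := by exact_mod_cast sub_eq_zero.1 hq'
    have h3 : (3 : ℤ) ∣ n := Int.prime_three.dvd_of_dvd_pow ⟨_, hn⟩
    obtain ⟨m, rfl⟩ := h3
    apply hd
    have : (3 : ℤ) ∣ d := ⟨m ^ 2, by linarith⟩
    exact_mod_cast this
  rw [quadField, IntermediateField.adjoin.finrank ⟨p, hmonic, hroot⟩,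
    ← minpoly.eq_of_irreducible_of_monic hirr hroot hmonic, hdeg]

/-- The cubic polynomial `X³ - 3X + 1`. -/
noncomputable def cubicPoly : ℚ[X] := X ^ 3 - C 3 * X + C 1

theorem cubicPoly_monic : cubicPoly.Monic := by rw [cubicPoly]; monicity!

theorem cubicPoly_natDegree : cubicPoly.natDegree = 3 := by rw [cubicPoly]; compute_degree!

theorem aeval_cubicPoly : aeval (2 * Real.cos (2 * Real.pi / 9)) cubicPoly = 0 := by
  have := cos_cubic
  simpa [cubicPoly] using this

theorem cubicPoly_irreducible : Irreducible cubicPoly := by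
  rw [cubicPoly_monic.irreducible_iff_roots_eq_zero_of_degree_le_three
    (by rw [cubicPoly_natDegree]; omega) (by rw [cubicPoly_natDegree]),
    Multiset.eq_zero_iff_forall_notMem]
  intro q hq
  have hq' : q ^ 3 - 3 * q + 1 = 0 := by
    have := (mem_roots'.1 hq).2
    simpa [cubicPoly, IsRoot.def] using this
  obtain ⟨n, rfl⟩ := exists_int_of_isIntegral (q := q)
    ⟨X ^ 3 - C 3 * X + C 1, by monicity!, by simpa using hq'⟩
  have hn : n ^ 3 - 3 * n + 1 = 0 := by exact_mod_cast hq'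
  have hdvd : n ∣ 1 := ⟨3 - n ^ 2, by linarith⟩
  rcases Int.isUnit_iff.1 (isUnit_of_dvd_one hdvd) with rfl | rfl <;> norm_num at hn

theorem finrank_cubicField : Module.finrank ℚ cubicField = 3 := by
  rw [cubicField, IntermediateField.adjoin.finrank ⟨cubicPoly, cubicPoly_monic, aeval_cubicPoly⟩,
    ← minpoly.eq_of_irreducible_of_monic cubicPoly_irreducible aeval_cubicPoly cubicPoly_monic,
    cubicPoly_natDegree]

/-- Doubling the angle in `2 cos` sends a root `t` to `t² - 2`; the third root makes the sum zero.
-/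
theorem cubic_factor {R : Type*} [CommRing R] {t : R} (ht : t ^ 3 - 3 * t + 1 = 0) (x : R) :
    x ^ 3 - 3 * x + 1 = (x - t) * (x - (t ^ 2 - 2)) * (x - (2 - t - t ^ 2)) := by
  linear_combination (1 + (x - t) * (t + 1)) * ht

theorem cubicField_normal : @Normal ℚ cubicField _ _ cubicField.algebra' := by
  have hmem : 2 * Real.cos (2 * Real.pi / 9) ∈ cubicField := mem_adjoin_simple_self ℚ _
  have hsplit : cubicPoly.map (algebraMap ℚ ℝ) =
      (X - C (2 * Real.cos (2 * Real.pi / 9))) *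
      (X - C ((2 * Real.cos (2 * Real.pi / 9)) ^ 2 - 2)) *
      (X - C (2 - 2 * Real.cos (2 * Real.pi / 9) - (2 * Real.cos (2 * Real.pi / 9)) ^ 2)) := by
    have ht : (C (2 * Real.cos (2 * Real.pi / 9)) : ℝ[X]) ^ 3 -
        3 * C (2 * Real.cos (2 * Real.pi / 9)) + 1 = 0 := by
      have := congrArg (C : ℝ → ℝ[X]) cos_cubic
      simpa only [map_add, map_sub, map_mul, map_pow, map_one, map_zero, map_ofNat] using this
    have h3 : cubicPoly.map (algebraMap ℚ ℝ) = X ^ 3 - 3 * X + 1 := by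
      simp only [cubicPoly, Polynomial.map_add, Polynomial.map_sub, Polynomial.map_mul,
        Polynomial.map_pow, map_X, map_ofNat, map_one, Polynomial.map_ofNat, Polynomial.map_one]
    rw [h3, cubic_factor ht X]
    simp only [map_sub, map_pow, map_ofNat]
  have hS : (cubicPoly.map (algebraMap ℚ ℝ)).Splits := by
    rw [hsplit]
    exact ((Splits.X_sub_C _).mul (Splits.X_sub_C _)).mul (Splits.X_sub_C _)
  have heq : cubicField = adjoin ℚ (cubicPoly.rootSet ℝ) := by
    apply le_antisymm
    · rw [cubicField, adjoin_simple_le_iff]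
      exact subset_adjoin _ _ ((mem_rootSet.2 ⟨cubicPoly_monic.ne_zero, aeval_cubicPoly⟩))
    · rw [adjoin_le_iff]
      intro x hx
      have hx' : x ^ 3 - 3 * x + 1 = 0 := by
        have := (mem_rootSet.1 hx).2
        simpa [cubicPoly] using this
      rw [cubic_factor cos_cubic, mul_eq_zero, mul_eq_zero, sub_eq_zero, sub_eq_zero,
        sub_eq_zero] at hx'
      have h2 : (2 : ℝ) ∈ cubicField := ofNat_mem _ 2
      rcases hx' with (rfl | rfl) | rfl
      · exact hmem
      · exact sub_mem (pow_mem hmem 2) h2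
      · exact sub_mem (sub_mem h2 hmem) (pow_mem hmem 2)
  have := adjoin_rootSet_isSplittingField hS
  rw [← heq] at this
  exact @Normal.of_isSplittingField _ _ _ _ _ cubicPoly this

section Degrees

variable {d : ℕ}

instance finiteDimensional_quadField : FiniteDimensional ℚ (quadField d) := by
  refine adjoin.finiteDimensional ⟨X ^ 2 - C (3 * (d : ℚ)), by monicity!, ?_⟩
  rw [← aeval_def]
  simp only [map_sub, map_pow, aeval_X, aeval_C, sqrt_sq]
  simp

instance finiteDimensional_cubicField : FiniteDimensional ℚ cubicField :=
  Module.finite_of_finrank_pos (by rw [finrank_cubicField]; norm_num)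

instance finiteDimensional_K₁ : FiniteDimensional ℚ (K₁ d) := by
  unfold K₁
  infer_instance

instance numberField_K₁ : NumberField (K₁ d) where

theorem linearDisjoint_quad_cubic (hd : ¬ 3 ∣ d) : (quadField d).LinearDisjoint cubicField :=
  LinearDisjoint.of_finrank_coprime (by rw [finrank_quadField hd, finrank_cubicField]; norm_num)

theorem finrank_K₁ (hd : ¬ 3 ∣ d) : Module.finrank ℚ (K₁ d) = 6 := by
  rw [K₁, (linearDisjoint_quad_cubic hd).finrank_sup, finrank_quadField hd, finrank_cubicField]

theorem finrank_K₀ (hd : ¬ 3 ∣ d) : Module.finrank ℚ (K₀ d) = 2 := by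
  rw [← finrank_quadField hd]
  exact (restrictAlgEquiv _).symm.toLinearEquiv.finrank_eq

theorem finrank_B₁ : Module.finrank ℚ (B₁ d) = 3 := by
  rw [← finrank_cubicField]
  exact (restrictAlgEquiv _).symm.toLinearEquiv.finrank_eq

theorem finrank_K₀_K₁ (hd : ¬ 3 ∣ d) : Module.finrank (K₀ d) (K₁ d) = 3 := by
  have := Module.finrank_mul_finrank ℚ (K₀ d) (K₁ d)
  rw [finrank_K₁ hd, finrank_K₀ hd] at this
  omega

theorem finrank_B₁_K₁ (hd : ¬ 3 ∣ d) : Module.finrank (B₁ d) (K₁ d) = 2 := by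
  have := Module.finrank_mul_finrank ℚ (B₁ d) (K₁ d)
  rw [finrank_K₁ hd, finrank_B₁] at this
  omega

theorem isGalois_rat_K₁ (hd : ¬ 3 ∣ d) : IsGalois ℚ (K₁ d) := by
  have : Algebra.IsQuadraticExtension ℚ (quadField d) := ⟨finrank_quadField hd⟩
  have h1 : @Normal ℚ (quadField d) _ _ (quadField d).algebra' :=
    inferInstanceAs (Normal ℚ (quadField d))
  have h2 : Normal ℚ (K₁ d) :=
    @IntermediateField.normal_sup ℚ ℝ _ _ _ (quadField d) cubicField h1 cubicField_normal
  exact { }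

theorem K₁_eq_adjoin : K₁ d = adjoin ℚ {√(3 * (d : ℝ)), 2 * Real.cos (2 * Real.pi / 9)} := by
  rw [K₁, quadField, cubicField, ← adjoin_union]
  rfl

theorem K₁_algHom_ext {A : Type*} [Field A] [Algebra ℚ A] {φ ψ : K₁ d →ₐ[ℚ] A}
    (h1 : φ (sqrtElt d) = ψ (sqrtElt d)) (h2 : φ (cosElt d) = ψ (cosElt d)) : φ = ψ := by
  refine algHom_ext_of_eq_adjoin ℚ K₁_eq_adjoin ?_
  rintro x (rfl | rfl)
  · exact h1
  · exact h2

theorem sqrtElt_mem : sqrtElt d ∈ K₀ d :=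
  (mem_restrict _ _).2 (mem_adjoin_simple_self ℚ _)

theorem cosElt_mem : cosElt d ∈ B₁ d :=
  (mem_restrict _ _).2 (mem_adjoin_simple_self ℚ _)

/-- Any complex embedding sends both generators to roots of polynomials that split over the reals,
so it equals its conjugate. -/
instance isTotallyReal_K₁ : IsTotallyReal (K₁ d) := by
  refine ⟨fun w => ?_⟩
  rw [InfinitePlace.isReal_iff, ComplexEmbedding.isReal_iff]
  set φ : K₁ d →+* ℂ := w.embedding
  have h3 : φ 3 = 3 := map_ofNat φ 3
  have hs : φ (sqrtElt d) ^ 2 = 3 * d := by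
    rw [← map_pow, sqrtElt_sq, map_mul, h3, map_natCast]
  have ht : φ (cosElt d) ^ 3 - 3 * φ (cosElt d) + 1 = 0 := by
    have := congrArg φ (cosElt_cubic d)
    rwa [map_add, map_sub, map_mul, map_pow, map_one, map_zero, h3] at this
  have h1 : (starRingEnd ℂ) (φ (sqrtElt d)) = φ (sqrtElt d) := by
    have e : φ (sqrtElt d) ^ 2 = ((√(3 * (d : ℝ)) : ℝ) : ℂ) ^ 2 := by
      rw [hs, ← Complex.ofReal_pow, sqrt_sq]
      simp
    rcases sq_eq_sq_iff_eq_or_eq_neg.1 e with e | e <;> rw [e] <;> simp [Complex.conj_ofReal]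
  have h2 : (starRingEnd ℂ) (φ (cosElt d)) = φ (cosElt d) := by
    have hc : (((2 * Real.cos (2 * Real.pi / 9) : ℝ)) : ℂ) ^ 3 -
        3 * ((2 * Real.cos (2 * Real.pi / 9) : ℝ) : ℂ) + 1 = 0 := by
      exact_mod_cast congrArg (fun x : ℝ => (x : ℂ)) cos_cubic
    generalize (2 * Real.cos (2 * Real.pi / 9) : ℝ) = r at hc
    rw [cubic_factor hc, mul_eq_zero, mul_eq_zero, sub_eq_zero, sub_eq_zero, sub_eq_zero] at ht
    have hc2 : (starRingEnd ℂ) 2 = 2 := map_ofNat _ 2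
    rcases ht with (e | e) | e <;> rw [e] <;> simp [Complex.conj_ofReal, hc2]
  have key : (ComplexEmbedding.conjugate φ).toRatAlgHom = φ.toRatAlgHom :=
    K₁_algHom_ext h1 h2
  exact congrArg (fun f : K₁ d →ₐ[ℚ] ℂ => (f : K₁ d →+* ℂ)) key

end Degrees

end KummerUnits

namespace KummerUnits

/-! ### Total ramification at 3. -/

section Ramification

variable {K : Type*} [Field K] [NumberField K]

theorem absNorm_eq_three_of_pow_six (hK : Module.finrank ℚ K = 6) {P : Ideal (𝓞 K)}
    (hP : P ^ 6 = Ideal.span {(3 : 𝓞 K)}) : Ideal.absNorm P = 3 := by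
  have h := congrArg Ideal.absNorm hP
  have h3 : (3 : 𝓞 K) = algebraMap ℤ (𝓞 K) 3 := (map_ofNat _ 3).symm
  rw [map_pow, Ideal.absNorm_span_singleton, h3, Algebra.norm_algebraMap,
    RingOfIntegers.rank, hK, Int.natAbs_pow] at h
  exact Nat.pow_left_injective (n := 6) (by norm_num) h

/-- If the prime `3` is totally ramified in `K`, the primes dividing `3` are explicitly generated
by `θ + 1` and `t`, and hence the divisors of `f'(θ)`, where `f = X³ - 3X + 1`, are invariant under
any automorphism which fixes `θ` and maps `t` to `± t`. -/
theorem map_eq_of_dvd_different (hK : Module.finrank ℚ K = 6) {d : ℤ} (hd : IsCoprime 3 d)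
    {θ t : 𝓞 K} (hθ : θ ^ 3 - 3 * θ + 1 = 0)
    (ht : t ^ 2 = d * (θ + 1) * ((3 - θ ^ 2) * (θ - 1) ^ 2)) {g : 𝓞 K ≃+* 𝓞 K} (hgθ : g θ = θ)
    (hgt : g t = t ∨ g t = -t) (I : Ideal (𝓞 K)) (hI : I ∣ Ideal.span {3 * θ ^ 2 - 3}) :
    I.map (g : 𝓞 K →+* 𝓞 K) = I := by
  set ϖ := θ + 1 with hϖ
  set P : Ideal (𝓞 K) := Ideal.span {ϖ, t} with hP
  have h3 : (3 : 𝓞 K) = ϖ ^ 3 * ((3 - θ ^ 2) * (θ - 1) ^ 2) := by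
    rw [hϖ]
    linear_combination (θ ^ 4 + θ ^ 3 - 2 * θ ^ 2 - 3 * θ) * hθ
  have hη : ((3 - θ ^ 2) * (θ - 1) ^ 2) * (θ * (θ + 2)) = 1 := by
    linear_combination (-θ ^ 3 + 3 * θ - 1) * hθ
  have hdiff : 3 * θ ^ 2 - 3 = ϖ ^ 4 * ((3 - θ ^ 2) * (θ - 1) ^ 2 * (θ - 1)) := by
    rw [hϖ]
    linear_combination (θ ^ 6 + θ ^ 5 - 3 * θ ^ 4 - 4 * θ ^ 3 + 2 * θ ^ 2 + 3 * θ) * hθ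
  have hunit : (θ - 1) * ((θ - 1) * (θ + 2)) = 1 := by
    linear_combination hθ
  clear_value ϖ
  generalize (3 - θ ^ 2) * (θ - 1) ^ 2 = η at *
  generalize θ * (θ + 2) = η' at *
  -- `t²` is `dϖ` times a unit and `ϖ²` divides `3ϖ`; as `d` is prime to 3, a Bézout relation
  -- recovers `ϖ` from `ϖ²` and `t²`.
  have hP2 : P ^ 2 = Ideal.span {ϖ} := by
    rw [pow_two, hP, Ideal.span_pair_mul_span_pair]
    apply le_antisymm
    · rw [Ideal.span_le]
      rintro _ (rfl | rfl | rfl | rfl) <;> rw [SetLike.mem_coe, Ideal.mem_span_singleton]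
      · exact dvd_mul_left _ _
      · exact dvd_mul_right _ _
      · exact dvd_mul_left _ _
      · exact ⟨d * η, by rw [← pow_two, ht]; ring⟩
    · rw [Ideal.span_singleton_le_iff_mem]
      obtain ⟨a, b, hab⟩ := hd
      have hab' : (a : 𝓞 K) * 3 + b * d = 1 := by exact_mod_cast congrArg (Int.cast (R := 𝓞 K)) hab
      have hϖP : ϖ = (a * η * ϖ ^ 2) * (ϖ * ϖ) + (b * η') * (t * t) := by
        linear_combination (-ϖ) * hab' + a * ϖ * h3 - b * η' * ht - b * d * ϖ * hη
      rw [hϖP]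
      exact add_mem (Ideal.mul_mem_left _ _ (Ideal.subset_span (by simp [← hϖP])))
        (Ideal.mul_mem_left _ _ (Ideal.subset_span (by simp)))
  have hP6 : P ^ 6 = Ideal.span {(3 : 𝓞 K)} := by
    rw [show 6 = 2 * 3 by norm_num, pow_mul, hP2, Ideal.span_singleton_pow,
      Ideal.span_singleton_eq_span_singleton]
    exact ⟨⟨η, η', hη, by rw [mul_comm, hη]⟩, h3.symm⟩
  have hP8 : Ideal.span {3 * θ ^ 2 - 3} ∣ P ^ 8 := by
    rw [show 8 = 2 * 4 by norm_num, pow_mul, hP2, Ideal.span_singleton_pow, Ideal.dvd_iff_le,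
      Ideal.span_singleton_le_span_singleton]
    refine ⟨η' * ((θ - 1) * (θ + 2)), ?_⟩
    rw [hdiff]
    linear_combination (-ϖ ^ 4) * hη - ϖ ^ 4 * η * η' * hunit
  have hnorm := absNorm_eq_three_of_pow_six hK hP6
  have hprime : P.IsPrime :=
    Ideal.isPrime_of_irreducible_absNorm (by rw [hnorm]; exact Nat.prime_three)
  have hP0 : P ≠ ⊥ := by
    intro h0
    rw [h0, Ideal.absNorm_bot] at hnorm
    norm_num at hnorm
  -- `f'(θ)` is `ϖ⁴` times a unit, so its ideal is `P⁸`, with `P` prime because its norm is 3.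
  obtain ⟨k, -, hk⟩ := (dvd_prime_pow (Ideal.prime_of_isPrime hP0 hprime) _).1 (hI.trans hP8)
  rw [associated_iff_eq] at hk
  have hgP : P.map (g : 𝓞 K →+* 𝓞 K) = P := by
    rw [hP, Ideal.map_span, Set.image_pair]
    have e1 : (g : 𝓞 K →+* 𝓞 K) ϖ = ϖ := by
      rw [hϖ]
      change g (θ + 1) = θ + 1
      rw [map_add, hgθ, map_one]
    have e2 : (g : 𝓞 K →+* 𝓞 K) t = g t := rfl
    rw [e1, e2]
    rcases hgt with h | h
    · rw [h]
    · rw [h, Ideal.span_insert, Ideal.span_insert, Ideal.span_singleton_neg]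
  rw [hk, Ideal.map_pow, hgP]

end Ramification

end KummerUnits

namespace KummerUnits

theorem ideal_map_injective {F K : Type*} [Field F] [NumberField F] [Field K] [NumberField K]
    [Algebra F K] {J J' : Ideal (𝓞 F)}
    (hJ : J.map (algebraMap (𝓞 F) (𝓞 K)) = J'.map (algebraMap (𝓞 F) (𝓞 K))) : J = J' := by
  apply FractionalIdeal.coeIdeal_injective (K := F)
  apply FractionalIdeal.extendedHom_injective (𝓞 F) F (L := K) (B := 𝓞 K)
  simp only [FractionalIdeal.extendedHom_coeIdeal_eq_map, hJ]

/-- An involution of a ring which preserves a subring restricts to it. -/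
theorem exists_restrict_involution {S R : Type*} [CommRing S] [CommRing R] {φ : S →+* R}
    (hφ : Function.Injective φ) {g : R ≃+* R} (hg : ∀ x, g (g x) = x)
    (h : ∀ s, ∃ s', φ s' = g (φ s)) :
    ∃ σ : S ≃+* S, (∀ s, g (φ s) = φ (σ s)) ∧ ∀ s, σ (σ s) = s := by
  choose f hf using h
  have hff : ∀ s, f (f s) = s := fun s => hφ (by rw [hf, hf, hg])
  exact ⟨{ toFun := f
           invFun := f
           left_inv := hff
           right_inv := hff
           map_mul' := fun x y => hφ (by simp only [hf, map_mul])
           map_add' := fun x y => hφ (by simp only [hf, map_add]) }, fun s => (hf s).symm, hff⟩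

/-! ### The Galois action on the two generators. -/

section Galois

variable {d : ℕ} (hd : ¬ 3 ∣ d)

include hd

theorem isGalois_K₀_K₁ : IsGalois (K₀ d) (K₁ d) := by
  have := isGalois_rat_K₁ hd
  exact IsGalois.tower_top_of_isGalois ℚ (K₀ d) (K₁ d)

theorem isGalois_B₁_K₁ : IsGalois (B₁ d) (K₁ d) := by
  have := isGalois_rat_K₁ hd
  exact IsGalois.tower_top_of_isGalois ℚ (B₁ d) (K₁ d)

theorem τ_τ_τ_apply (τ : K₁ d ≃ₐ[K₀ d] K₁ d) (x : K₁ d) : τ (τ (τ x)) = x := by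
  have := isGalois_K₀_K₁ hd
  have h := pow_finrank_eq_one (τ := τ)
  rw [finrank_K₀_K₁ hd] at h
  exact congrArg (fun f : K₁ d ≃ₐ[K₀ d] K₁ d => f x) h

theorem g_g_apply (g : K₁ d ≃ₐ[B₁ d] K₁ d) (x : K₁ d) : g (g x) = x := by
  have := isGalois_B₁_K₁ hd
  have h := pow_finrank_eq_one (τ := g)
  rw [finrank_B₁_K₁ hd] at h
  exact congrArg (fun f : K₁ d ≃ₐ[B₁ d] K₁ d => f x) h

omit hd in
theorem τ_sqrtElt (τ : K₁ d ≃ₐ[K₀ d] K₁ d) : τ (sqrtElt d) = sqrtElt d :=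
  τ.commutes (⟨sqrtElt d, sqrtElt_mem⟩ : K₀ d)

omit hd in
theorem g_cosElt (g : K₁ d ≃ₐ[B₁ d] K₁ d) : g (cosElt d) = cosElt d :=
  g.commutes (⟨cosElt d, cosElt_mem⟩ : B₁ d)

omit hd in
theorem g_sqrtElt (g : K₁ d ≃ₐ[B₁ d] K₁ d) :
    g (sqrtElt d) = sqrtElt d ∨ g (sqrtElt d) = -sqrtElt d := by
  apply sq_eq_sq_iff_eq_or_eq_neg.1
  rw [← map_pow, sqrtElt_sq, map_mul, map_natCast, map_ofNat]

omit hd in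
theorem τ_cosElt (τ : K₁ d ≃ₐ[K₀ d] K₁ d) :
    τ (cosElt d) = cosElt d ∨ τ (cosElt d) = cosElt d ^ 2 - 2 ∨
      τ (cosElt d) = 2 - cosElt d - cosElt d ^ 2 := by
  have h := congrArg τ (cosElt_cubic d)
  rw [map_add, map_sub, map_mul, map_pow, map_one, map_zero, map_ofNat,
    cubic_factor (cosElt_cubic d), mul_eq_zero, mul_eq_zero, sub_eq_zero, sub_eq_zero,
    sub_eq_zero, or_assoc] at h
  exact h

omit hd in
theorem K₁_ringHom_ext {φ ψ : K₁ d →+* K₁ d} (h1 : φ (sqrtElt d) = ψ (sqrtElt d))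
    (h2 : φ (cosElt d) = ψ (cosElt d)) (x : K₁ d) : φ x = ψ x := by
  have key : φ.toRatAlgHom = ψ.toRatAlgHom := K₁_algHom_ext h1 h2
  exact congrArg (fun f : K₁ d →ₐ[ℚ] K₁ d => f x) key

omit hd in
theorem g_τ_apply (g : K₁ d ≃ₐ[B₁ d] K₁ d) (τ : K₁ d ≃ₐ[K₀ d] K₁ d) (x : K₁ d) :
    g (τ x) = τ (g x) := by
  refine K₁_ringHom_ext (φ := ((g : K₁ d →+* K₁ d)).comp (τ : K₁ d →+* K₁ d))
    (ψ := ((τ : K₁ d →+* K₁ d)).comp (g : K₁ d →+* K₁ d)) ?_ ?_ x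
  · change g (τ (sqrtElt d)) = τ (g (sqrtElt d))
    rw [τ_sqrtElt]
    rcases g_sqrtElt g with h | h
    · rw [h, τ_sqrtElt]
    · rw [h, map_neg, τ_sqrtElt]
  · change g (τ (cosElt d)) = τ (g (cosElt d))
    rw [g_cosElt]
    rcases τ_cosElt τ with h | h | h <;> rw [h] <;>
      simp only [map_sub, map_pow, map_ofNat, g_cosElt]

theorem τ_cosElt_ne {τ : K₁ d ≃ₐ[K₀ d] K₁ d} (hτ : Subgroup.zpowers τ = ⊤) :
    τ (cosElt d) ≠ cosElt d := by
  intro h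
  have hid : ∀ x, τ x = x := K₁_ringHom_ext (φ := (τ : K₁ d →+* K₁ d)) (ψ := RingHom.id _)
    (τ_sqrtElt τ) h
  have h1 : τ = 1 := AlgEquiv.ext hid
  have := isGalois_K₀_K₁ hd
  have hcard : Nat.card (K₁ d ≃ₐ[K₀ d] K₁ d) = 3 := by
    rw [IsGalois.card_aut_eq_finrank, finrank_K₀_K₁ hd]
  rw [← Subgroup.card_top, ← hτ, h1, Subgroup.zpowers_one_eq_bot, Subgroup.card_bot] at hcard
  norm_num at hcard

theorem exists_rat_of_fixed {g : K₁ d ≃ₐ[B₁ d] K₁ d} (hg : Subgroup.zpowers g = ⊤)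
    {τ : K₁ d ≃ₐ[K₀ d] K₁ d} (hτ : Subgroup.zpowers τ = ⊤) {x : K₁ d} (h1 : g x = x)
    (h2 : τ x = x) : ∃ q : ℚ, (q : K₁ d) = x := by
  have := isGalois_K₀_K₁ hd
  have := isGalois_B₁_K₁ hd
  obtain ⟨y, hy⟩ := exists_algebraMap_eq_of_fixed hτ h2
  obtain ⟨z, hz⟩ := exists_algebraMap_eq_of_fixed hg h1
  have hx0 : (x : ℝ) ∈ quadField d := by
    rw [← hy]
    exact (IntermediateField.mem_restrict _ _).1 y.2
  have hx1 : (x : ℝ) ∈ cubicField := by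
    rw [← hz]
    exact (IntermediateField.mem_restrict _ _).1 z.2
  have hbot : (x : ℝ) ∈ quadField d ⊓ cubicField := ⟨hx0, hx1⟩
  rw [(linearDisjoint_quad_cubic hd).inf_eq_bot, IntermediateField.mem_bot] at hbot
  obtain ⟨q, hq⟩ := hbot
  refine ⟨q, Subtype.ext ?_⟩
  rw [← hq]
  simp

theorem exists_int_of_fixed {g : K₁ d ≃ₐ[B₁ d] K₁ d} (hg : Subgroup.zpowers g = ⊤)
    {τ : K₁ d ≃ₐ[K₀ d] K₁ d} (hτ : Subgroup.zpowers τ = ⊤) {x : 𝓞 (K₁ d)}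
    (h1 : g (x : K₁ d) = x) (h2 : τ (x : K₁ d) = x) : ∃ n : ℤ, (n : 𝓞 (K₁ d)) = x := by
  obtain ⟨q, hq⟩ := exists_rat_of_fixed hd hg hτ h1 h2
  have hintegral : IsIntegral ℤ q := by
    rw [← isIntegral_algebraMap_iff (algebraMap ℚ (K₁ d)).injective, eq_ratCast, hq]
    exact x.2
  obtain ⟨n, rfl⟩ := exists_int_of_isIntegral hintegral
  refine ⟨n, RingOfIntegers.ext ?_⟩
  rw [← hq]
  simp

/-- The trace relations satisfied by the conjugates of `2 cos (2π/9)`. -/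
theorem cosElt_relations {τ : K₁ d ≃ₐ[K₀ d] K₁ d} (hτ : Subgroup.zpowers τ = ⊤) :
    cosElt d + τ (cosElt d) + τ (τ (cosElt d)) = 0 ∧
      cosElt d * τ (cosElt d) + cosElt d * τ (τ (cosElt d)) + τ (cosElt d) * τ (τ (cosElt d)) =
        -3 := by
  have hc := cosElt_cubic d
  have hττ : τ (τ (cosElt d)) = - cosElt d - τ (cosElt d) := by
    rcases τ_cosElt τ with h | h | h
    · exact absurd h (τ_cosElt_ne hd hτ)
    · rw [h]
      simp only [map_sub, map_pow, map_ofNat, h]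
      linear_combination cosElt d * hc
    · rw [h]
      simp only [map_sub, map_pow, map_ofNat, h]
      linear_combination (-cosElt d - 2) * hc
  rw [hττ]
  refine ⟨by ring, ?_⟩
  rcases τ_cosElt τ with h | h | h
  · exact absurd h (τ_cosElt_ne hd hτ)
  · rw [h]
    linear_combination (-cosElt d - 1) * hc
  · rw [h]
    linear_combination (-cosElt d - 1) * hc

end Galois

end KummerUnits

namespace KummerUnits

/-! ### `K₁/K₀` satisfies the axioms of `CubicExtension`. -/

variable {d : ℕ}

theorem isIntegral_cosElt : IsIntegral ℤ (cosElt d) := by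
  refine ⟨Polynomial.X ^ 3 - Polynomial.C 3 * Polynomial.X + Polynomial.C 1, by monicity!, ?_⟩
  have := cosElt_cubic d
  simpa using this

/-- `2 cos (2π/9)` as an algebraic integer. -/
noncomputable def cosInt (d : ℕ) : 𝓞 (K₁ d) := ⟨cosElt d, isIntegral_cosElt⟩

theorem coe_cosInt : ((cosInt d : 𝓞 (K₁ d)) : K₁ d) = cosElt d := rfl

theorem cosInt_cubic : cosInt d ^ 3 - 3 * cosInt d + 1 = 0 := by
  apply RingOfIntegers.ext
  have := cosElt_cubic d
  simpa only [map_add, map_sub, map_mul, map_pow, map_one, map_zero, map_ofNat, coe_cosInt]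
    using this

/-- The element `√(3d) / (θ + 1)`, where `θ = 2 cos (2π/9)`, generates together with `θ + 1` the
prime of `K₁` above `3`. -/
theorem exists_uniformizer (d : ℕ) : ∃ t : 𝓞 (K₁ d),
    t ^ 2 = (d : ℤ) * (cosInt d + 1) * ((3 - cosInt d ^ 2) * (cosInt d - 1) ^ 2) ∧
      ∀ g : K₁ d ≃ₐ[B₁ d] K₁ d, g (t : K₁ d) = t ∨ g (t : K₁ d) = -t := by
  set c := cosElt d with hc
  have hcub : c ^ 3 - 3 * c + 1 = 0 := cosElt_cubic d
  -- This is `√(3d)/(c+1)`, because `(c+1)³(3-c²)(c-1)² = 3`.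
  set t : K₁ d := sqrtElt d * ((c + 1) ^ 2 * ((3 - c ^ 2) * (c - 1) ^ 2) / 3) with ht
  have h3 : (3 : K₁ d) ≠ 0 := by norm_num
  have ht2 : t ^ 2 = d * (c + 1) * ((3 - c ^ 2) * (c - 1) ^ 2) := by
    have h4 : (3 : K₁ d) = (c + 1) ^ 3 * ((3 - c ^ 2) * (c - 1) ^ 2) := by
      linear_combination (c ^ 4 + c ^ 3 - 2 * c ^ 2 - 3 * c) * hcub
    rw [ht, mul_pow, sqrtElt_sq, div_pow]
    generalize (3 - c ^ 2) * (c - 1) ^ 2 = η at *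
    field_simp
    linear_combination (-(d : K₁ d) * (c + 1) * η) * h4
  have hintegral : IsIntegral ℤ t := by
    refine IsIntegral.of_pow (n := 2) (by norm_num) ?_
    rw [ht2]
    have hci : IsIntegral ℤ c := isIntegral_cosElt
    have h1 : IsIntegral ℤ (1 : K₁ d) := isIntegral_one
    have h3i : IsIntegral ℤ (3 : K₁ d) := by
      have := isIntegral_algebraMap (R := ℤ) (A := K₁ d) (x := 3)
      simpa using this
    have hdi : IsIntegral ℤ (d : K₁ d) := by
      have := isIntegral_algebraMap (R := ℤ) (A := K₁ d) (x := (d : ℤ))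
      simpa using this
    exact (hdi.mul (hci.add h1)).mul ((h3i.sub (hci.pow 2)).mul ((hci.sub h1).pow 2))
  obtain ⟨t', ht'⟩ : ∃ t' : 𝓞 (K₁ d), (t' : K₁ d) = t := ⟨⟨t, hintegral⟩, rfl⟩
  refine ⟨t', ?_, ?_⟩
  · apply RingOfIntegers.ext
    have ht'' : algebraMap (𝓞 (K₁ d)) (K₁ d) t' = t := ht'
    have hc' : algebraMap (𝓞 (K₁ d)) (K₁ d) (cosInt d) = c := rfl
    rw [RingOfIntegers.coe_eq_algebraMap, RingOfIntegers.coe_eq_algebraMap, map_pow, ht'', ht2]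
    simp only [map_add, map_sub, map_mul, map_pow, map_one, map_ofNat, map_natCast, hc', Int.cast_natCast]
  · intro g
    rw [ht', ht, map_mul]
    simp only [map_div₀, map_add, map_sub, map_mul, map_pow, map_one, map_ofNat, hc, g_cosElt]
    rcases g_sqrtElt g with h | h <;> rw [h]
    · left
      rfl
    · right
      rw [neg_mul]

/-- The extension of rings of integers of `K₁ / K₀` has the properties needed for the analysis of
capitulation. -/
theorem exists_cubicExtension (hd : ¬ 3 ∣ d) {g : K₁ d ≃ₐ[B₁ d] K₁ d}
    (hg : Subgroup.zpowers g = ⊤) {τ : K₁ d ≃ₐ[K₀ d] K₁ d} (hτ : Subgroup.zpowers τ = ⊤) :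
    ∃ (σ : 𝓞 (K₀ d) ≃+* 𝓞 (K₀ d)) (θ : 𝓞 (K₁ d)),
      CubicExtension σ (RingOfIntegers.mapRingEquiv g.toRingEquiv)
        (RingOfIntegers.mapRingEquiv τ.toRingEquiv) θ := by
  have := isGalois_K₀_K₁ hd
  have hinj : Function.Injective (algebraMap (𝓞 (K₀ d)) (𝓞 (K₁ d))) :=
    FaithfulSMul.algebraMap_injective _ _
  have hττ : ∀ s : 𝓞 (K₀ d), RingOfIntegers.mapRingEquiv τ.toRingEquiv
      (algebraMap (𝓞 (K₀ d)) (𝓞 (K₁ d)) s) = algebraMap (𝓞 (K₀ d)) (𝓞 (K₁ d)) s := fun s =>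
    RingOfIntegers.ext (τ.commutes (s : K₀ d))
  have hgg : ∀ x : 𝓞 (K₁ d), RingOfIntegers.mapRingEquiv g.toRingEquiv
      (RingOfIntegers.mapRingEquiv g.toRingEquiv x) = x := fun x =>
    RingOfIntegers.ext (g_g_apply hd g x)
  have hgτ : ∀ x : 𝓞 (K₁ d), RingOfIntegers.mapRingEquiv g.toRingEquiv
      (RingOfIntegers.mapRingEquiv τ.toRingEquiv x) =
      RingOfIntegers.mapRingEquiv τ.toRingEquiv (RingOfIntegers.mapRingEquiv g.toRingEquiv x) :=
    fun x => RingOfIntegers.ext (g_τ_apply g τ x)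
  have hfix : ∀ x : 𝓞 (K₁ d), RingOfIntegers.mapRingEquiv τ.toRingEquiv x = x →
      ∃ s : 𝓞 (K₀ d), algebraMap (𝓞 (K₀ d)) (𝓞 (K₁ d)) s = x := fun x hx =>
    exists_integer_of_fixed hτ (congrArg (fun t : 𝓞 (K₁ d) => (t : K₁ d)) hx)
  obtain ⟨σ, hσ, hσσ⟩ := exists_restrict_involution hinj hgg (fun s => hfix _ (by
    rw [← hgτ, hττ]))
  obtain ⟨hθ1, hθ2⟩ := cosElt_relations hd hτ
  obtain ⟨t, ht, hgt⟩ := exists_uniformizer d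
  have hcop : IsCoprime (3 : ℤ) (d : ℤ) := by
    exact_mod_cast Nat.isCoprime_iff_coprime.2 ((Nat.prime_three.coprime_iff_not_dvd).2 hd)
  refine ⟨σ, cosInt d,
    { τ_τ_τ := fun x => RingOfIntegers.ext (τ_τ_τ_apply hd τ x)
      g_g := hgg
      g_τ := hgτ
      τ_algebraMap := hττ
      g_algebraMap := hσ
      fixed := hfix
      injective := hinj
      map_injective := fun J J' h => ideal_map_injective h
      conj := exists_mul_conj_eq_span_int σ hσσ fun x hx => ?_
      trace_θ := RingOfIntegers.ext ?_
      quad_θ := RingOfIntegers.ext ?_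
      ramified := fun I hI => map_eq_of_dvd_different (finrank_K₁ hd) hcop cosInt_cubic ht
        (RingOfIntegers.ext (g_cosElt g)) ?_ I hI
      different_ne_zero := fun h0 => ?_
      hilbert90 := fun v hv => ?_ }⟩
  · obtain ⟨n, hn⟩ := exists_int_of_fixed hd hg hτ
      (x := algebraMap (𝓞 (K₀ d)) (𝓞 (K₁ d)) x)
      (congrArg (fun t : 𝓞 (K₁ d) => (t : K₁ d)) ((hσ x).trans (by rw [hx])))
      (congrArg (fun t : 𝓞 (K₁ d) => (t : K₁ d)) (hττ x))
    exact ⟨n, hinj (by rw [← hn, map_intCast])⟩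
  · simp only [map_add, map_zero]
    exact hθ1
  · simp only [map_add, map_mul, map_neg, map_ofNat]
    exact hθ2
  · rcases hgt g with h | h
    · exact Or.inl (RingOfIntegers.ext h)
    · exact Or.inr (RingOfIntegers.ext h)
  · have hc := cosInt_cubic (d := d)
    -- A Bézout combination of `f` and `f'` equal to 27.
    have h27 : (27 : 𝓞 (K₁ d)) = 0 := by
      linear_combination ((6 * cosInt d + 3) * cosInt d - 12) * h0 -
        3 * (6 * cosInt d + 3) * hc
    norm_num at h27
  · obtain ⟨α, hα, h⟩ := exists_cobound_of_norm_eq_one hτ (finrank_K₀_K₁ hd) (v := (v : 𝓞 (K₁ d)))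
      (congrArg (fun t : 𝓞 (K₁ d) => (t : K₁ d)) hv)
    exact ⟨α, hα, RingOfIntegers.ext h⟩

end KummerUnits

namespace KummerUnits

/-! ### The units of `K₁` satisfy the axioms of `UnitModule`. -/

variable {d : ℕ}

/-- The inclusion `K₁ ⊆ ℝ`. -/
noncomputable def realEmb (d : ℕ) : K₁ d →+* ℝ := (K₁ d).val

theorem rank_K₁ (hd : ¬ 3 ∣ d) : Units.rank (K₁ d) = 5 := by
  rw [units_rank_eq_of_isTotallyReal, finrank_K₁ hd]

theorem rank_B₁ : Units.rank (B₁ d) = 2 := by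
  rw [units_rank_eq_of_isTotallyReal, finrank_B₁]

theorem rank_K₀ (hd : ¬ 3 ∣ d) : Units.rank (K₀ d) = 1 := by
  rw [units_rank_eq_of_isTotallyReal, finrank_K₀ hd]

theorem eq_one_or_neg_one_of_zpow {K : Type*} [Field K] (φ : K →+* ℝ) {u : (𝓞 K)ˣ} {n : ℤ}
    (hn : n ≠ 0) (hu : u ^ n = 1) : u = 1 ∨ u = -1 :=
  eq_one_or_eq_neg_one_of_pow φ (Int.natAbs_ne_zero.2 hn) (pow_natAbs_eq_one.2 hu)

theorem pow_three_injective {K : Type*} [Field K] (φ : K →+* ℝ) {u v : (𝓞 K)ˣ}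
    (h : u ^ 3 = v ^ 3) : u = v := by
  have h1 : (u / v) ^ 3 = 1 := by rw [div_pow, h, div_self']
  rcases eq_one_or_eq_neg_one_of_pow φ (by norm_num) h1 with h2 | h2
  · exact div_eq_one.1 h2
  · exfalso
    rw [h2] at h1
    have h3 := congrArg (fun t : (𝓞 K)ˣ => φ ((t : 𝓞 K) : K)) h1
    norm_num at h3

/-- A fundamental unit of `K₀` has infinite order. -/
theorem fundamentalUnit_zpow_ne_one (hd : ¬ 3 ∣ d) {ε₀ : (𝓞 (K₀ d))ˣ}
    (hε₀ : IsFundamentalUnit ε₀) {n : ℤ} (hn : ε₀ ^ n = 1) : n = 0 := by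
  by_contra hn0
  set φ : K₀ d →+* ℝ := (realEmb d).comp (algebraMap (K₀ d) (K₁ d))
  have hε := eq_one_or_neg_one_of_zpow φ hn0 hn
  -- Otherwise every unit of `K₀` squares to 1 and so is its own cube, against unit rank 1.
  have hcube : ∀ u : (𝓞 (K₀ d))ˣ, u = u ^ 3 := by
    intro u
    have hsq : ε₀ ^ 2 = 1 := by
      rcases hε with h | h <;> rw [h] <;> simp
    have hu2 : u ^ 2 = 1 := by
      obtain ⟨m, hm⟩ := hε₀ u
      have h1 : (ε₀ ^ m) ^ 2 = 1 := by
        rw [← zpow_natCast, ← zpow_mul, mul_comm, zpow_mul, zpow_natCast, hsq, one_zpow]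
      rcases hm with h | h <;> rw [h]
      · exact h1
      · rw [neg_sq, h1]
    rw [pow_succ, hu2, one_mul]
  have hfin := finrank_unitsModCubes φ
  rw [rank_K₀ hd] at hfin
  have hsub : Subsingleton (UnitsModCubes (K₀ d)) := by
    refine subsingleton_of_forall_eq 0 fun x => ?_
    obtain ⟨u, rfl⟩ := mkQ_surjective x
    refine mkQ_eq_zero_iff.2 ⟨u, ?_⟩
    exact hcube u.toMul
  rw [Module.finrank_zero_of_subsingleton] at hfin
  norm_num at hfin

theorem unitAct_apply {K : Type*} [Field K] (σ : K ≃+* K) (u : (𝓞 K)ˣ) :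
    ((unitAct σ u : 𝓞 K) : K) = σ ((u : 𝓞 K) : K) := rfl

theorem units_ext {K : Type*} [Field K] {u v : (𝓞 K)ˣ}
    (h : ((u : 𝓞 K) : K) = ((v : 𝓞 K) : K)) : u = v :=
  Units.ext (RingOfIntegers.ext h)

theorem unitAct_neg_one {K : Type*} [Field K] (σ : K ≃+* K) : unitAct σ (-1) = -1 := by
  apply units_ext
  rw [unitAct_apply]
  simp

section Dimension

/-- The space `M` has dimension `3`. -/
theorem finrank_M (hd : ¬ 3 ∣ d) {g : K₁ d ≃ₐ[B₁ d] K₁ d} (hg : Subgroup.zpowers g = ⊤) :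
    Module.finrank (ZMod 3) (M g.toRingEquiv) = 3 := by
  have := isGalois_B₁_K₁ hd
  set j : Additive (𝓞 (B₁ d))ˣ →+ Additive (𝓞 (K₁ d))ˣ :=
    (Units.map (algebraMap (𝓞 (B₁ d)) (𝓞 (K₁ d))).toMonoidHom).toAdditive with hj
  have hfixj : ∀ x, unitAct g.toRingEquiv (j x).toMul = (j x).toMul := fun x =>
    units_ext (g.commutes (((x.toMul : (𝓞 (B₁ d))ˣ) : 𝓞 (B₁ d)) : B₁ d))
  have hjinj : Function.Injective j := by
    intro x y hxy
    have h1 := congrArg (fun t : Additive (𝓞 (K₁ d))ˣ => ((t.toMul : 𝓞 (K₁ d)) : K₁ d)) hxy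
    have h2 : x.toMul = y.toMul := units_ext ((algebraMap (B₁ d) (K₁ d)).injective h1)
    exact h2
  -- A cube root in `K₁` of a unit of `B₁` is unique, hence fixed by `g`, hence in `B₁`.
  have hinj : Function.Injective (modThreeMap j) := by
    apply modThreeMap_injective
    intro x y hxy
    have hgy : unitAct g.toRingEquiv y.toMul = y.toMul := by
      apply pow_three_injective (realEmb d)
      have h1 := hfixj x
      have h2 : (j x).toMul = y.toMul ^ 3 := congrArg Additive.toMul hxy
      rw [h2, map_pow] at h1
      exact h1
    obtain ⟨w, hw⟩ := exists_unit_of_fixed hg (u := y.toMul)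
      (congrArg (fun t : (𝓞 (K₁ d))ˣ => ((t : 𝓞 (K₁ d)) : K₁ d)) hgy)
    refine ⟨Additive.ofMul w, hjinj ?_⟩
    rw [hxy, map_zsmul]
    exact congrArg (fun t : (𝓞 (K₁ d))ˣ => (3 : ℤ) • Additive.ofMul t) hw.symm
  have hker : LinearMap.ker (1 - actModCubes g.toRingEquiv) = LinearMap.range (modThreeMap j) := by
    apply le_antisymm
    · intro m hm
      obtain ⟨u, rfl⟩ := mkQ_surjective m
      rw [LinearMap.mem_ker, LinearMap.sub_apply, Module.End.one_apply] at hm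
      have hm' : (ModN.mkQ 3 u - ModN.mkQ 3 (Additive.ofMul (unitAct g.toRingEquiv u.toMul)) :
        UnitsModCubes (K₁ d)) = 0 := hm
      rw [← map_sub, mkQ_eq_zero_iff] at hm'
      obtain ⟨v, hv⟩ := hm'
      obtain ⟨w, hw⟩ := exists_unit_of_fixed hg (u := u.toMul * unitAct g.toRingEquiv u.toMul) (by
        have h1 : unitAct g.toRingEquiv (u.toMul * unitAct g.toRingEquiv u.toMul) =
            u.toMul * unitAct g.toRingEquiv u.toMul := by
          rw [map_mul, mul_comm]
          congr 1
          exact units_ext (g_g_apply hd g _)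
        exact congrArg (fun t : (𝓞 (K₁ d))ˣ => ((t : 𝓞 (K₁ d)) : K₁ d)) h1)
      -- If `gu ≡ u`, then `2(u + gu) ≡ 4u ≡ u` modulo 3, and `u + gu` comes from `B₁`.
      refine ⟨ModN.mkQ 3 ((2 : ℤ) • Additive.ofMul w), ?_⟩
      rw [modThreeMap_mkQ, ← sub_eq_zero, ← map_sub, mkQ_eq_zero_iff, map_zsmul]
      have hw' : j (Additive.ofMul w) =
          u + Additive.ofMul (unitAct g.toRingEquiv u.toMul) := congrArg Additive.ofMul hw
      refine ⟨u - (2 : ℤ) • v, ?_⟩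
      rw [hw']
      linear_combination (norm := module) (-2 : ℤ) • hv
    · rintro _ ⟨x, rfl⟩
      obtain ⟨x, rfl⟩ := mkQ_surjective x
      rw [modThreeMap_mkQ, LinearMap.mem_ker, LinearMap.sub_apply, Module.End.one_apply,
        sub_eq_zero]
      exact congrArg (fun t : (𝓞 (K₁ d))ˣ => unitClass t) (hfixj x).symm
  have hfin : Module.finrank (ZMod 3) (UnitsModCubes (K₁ d)) = 5 := by
    rw [finrank_unitsModCubes (realEmb d), rank_K₁ hd]
  have : Module.Finite (ZMod 3) (UnitsModCubes (K₁ d)) :=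
    Module.finite_of_finrank_pos (by rw [hfin]; norm_num)
  have h1 := LinearMap.finrank_range_add_finrank_ker (1 - actModCubes g.toRingEquiv)
  rw [hker, LinearMap.finrank_range_of_inj hinj, hfin] at h1
  have h2 : Module.finrank (ZMod 3) (ModN (Additive (𝓞 (B₁ d))ˣ) 3) = 2 :=
    (finrank_unitsModCubes ((realEmb d).comp (algebraMap (B₁ d) (K₁ d)))).trans rank_B₁
  rw [h2] at h1
  have h3 : Module.finrank (ZMod 3) (M g.toRingEquiv) + 2 = 5 := h1
  omega

end Dimension

theorem unitIncl_unitNorm (hd : ¬ 3 ∣ d) {τ : K₁ d ≃ₐ[K₀ d] K₁ d} (hτ : Subgroup.zpowers τ = ⊤)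
    (u : (𝓞 (K₁ d))ˣ) : unitIncl d (unitNorm d u) =
      u * unitAct τ.toRingEquiv u * unitAct τ.toRingEquiv (unitAct τ.toRingEquiv u) := by
  have := isGalois_K₀_K₁ hd
  exact units_ext (norm_eq_of_finrank_eq_three hτ (finrank_K₀_K₁ hd) ((u : 𝓞 (K₁ d)) : K₁ d))

theorem unitIncl_injective : Function.Injective (unitIncl d) := by
  intro u v h
  have h1 := congrArg (fun t : (𝓞 (K₁ d))ˣ => ((t : 𝓞 (K₁ d)) : K₁ d)) h
  exact units_ext ((algebraMap (K₀ d) (K₁ d)).injective h1)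

theorem unitIncl_neg_one : unitIncl d (-1) = -1 := by
  apply Units.ext
  simp [unitIncl]

theorem unitAct_unitIncl (τ : K₁ d ≃ₐ[K₀ d] K₁ d) (u : (𝓞 (K₀ d))ˣ) :
    unitAct τ.toRingEquiv (unitIncl d u) = unitIncl d u :=
  units_ext (τ.commutes ((u : 𝓞 (K₀ d)) : K₀ d))

/-- The unit group of `K₁` has the properties used in the classification. -/
theorem unitModule (hd : ¬ 3 ∣ d) {ε₀ : (𝓞 (K₀ d))ˣ} (hε₀ : IsFundamentalUnit ε₀)
    {g : K₁ d ≃ₐ[B₁ d] K₁ d} (hg : Subgroup.zpowers g = ⊤) {τ : K₁ d ≃ₐ[K₀ d] K₁ d}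
    (hτ : Subgroup.zpowers τ = ⊤) :
    UnitModule (unitAct g.toRingEquiv).toAdditive (unitAct τ.toRingEquiv).toAdditive
      (Additive.ofMul (unitIncl d ε₀)) (Additive.ofMul (-1)) := by
  have := isGalois_K₀_K₁ hd
  have hgτ : ∀ u : (𝓞 (K₁ d))ˣ, unitAct g.toRingEquiv (unitAct τ.toRingEquiv u) =
      unitAct τ.toRingEquiv (unitAct g.toRingEquiv u) := fun u => units_ext (g_τ_apply g τ _)
  have hgg : ∀ u : (𝓞 (K₁ d))ˣ, unitAct g.toRingEquiv (unitAct g.toRingEquiv u) = u :=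
    fun u => units_ext (g_g_apply hd g _)
  have hge : unitAct g.toRingEquiv (unitIncl d ε₀) = (unitIncl d ε₀)⁻¹ ∨
      unitAct g.toRingEquiv (unitIncl d ε₀) = (unitIncl d ε₀)⁻¹ * -1 := by
    set e := unitIncl d ε₀
    -- `e·ge` is fixed by `g` and `τ`, as is its inverse, so both are rational integers and `e·ge =
    -- ±1`.
    set n := e * unitAct g.toRingEquiv e with hn
    have hgn : unitAct g.toRingEquiv n = n := by rw [hn, map_mul, hgg, mul_comm]
    have hτn : unitAct τ.toRingEquiv n = n := by
      rw [hn, map_mul, ← hgτ, unitAct_unitIncl]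
    have hintegral : ∀ m : (𝓞 (K₁ d))ˣ, unitAct g.toRingEquiv m = m → unitAct τ.toRingEquiv m = m →
        ∃ k : ℤ, (k : 𝓞 (K₁ d)) = m := fun m h1 h2 =>
      exists_int_of_fixed hd hg hτ
        (congrArg (fun t : (𝓞 (K₁ d))ˣ => ((t : 𝓞 (K₁ d)) : K₁ d)) h1)
        (congrArg (fun t : (𝓞 (K₁ d))ˣ => ((t : 𝓞 (K₁ d)) : K₁ d)) h2)
    obtain ⟨k, hk⟩ := hintegral n hgn hτn
    obtain ⟨l, hl⟩ := hintegral n⁻¹ (by rw [map_inv, hgn]) (by rw [map_inv, hτn])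
    have hkl : k * l = 1 := by
      have h1 : ((k * l : ℤ) : 𝓞 (K₁ d)) = ((1 : ℤ) : 𝓞 (K₁ d)) := by
        rw [Int.cast_mul, hk, hl, Units.mul_inv, Int.cast_one]
      exact Int.cast_injective h1
    rcases Int.isUnit_iff.1 (IsUnit.of_mul_eq_one _ hkl) with rfl | rfl
    · left
      have h1 : n = 1 := Units.ext (by rw [← hk]; simp)
      rw [eq_inv_iff_mul_eq_one, mul_comm, ← hn, h1]
    · right
      have h1 : n = -1 := Units.ext (by rw [← hk]; simp)
      rw [eq_inv_mul_iff_mul_eq, ← hn, h1]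
  exact
    { g_g := fun x => hgg x.toMul
      τ_τ_τ := fun x => congrArg Additive.ofMul
        (units_ext (τ_τ_τ_apply hd τ ((x.toMul : 𝓞 (K₁ d)) : K₁ d)))
      g_τ := fun x => hgτ x.toMul
      two_t := by
        have h1 : (-1 : (𝓞 (K₁ d))ˣ) ^ (2 : ℤ) = 1 := by
          rw [show (2 : ℤ) = ((2 : ℕ) : ℤ) by norm_num, zpow_natCast]
          simp
        exact h1
      torsion := fun n x hn hx => eq_one_or_neg_one_of_zpow (realEmb d) (u := x.toMul) hn hx
      fixed := fun x hx => by
        obtain ⟨w, hw⟩ := exists_unit_of_fixed hτ (u := x.toMul)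
          (congrArg (fun t : Additive (𝓞 (K₁ d))ˣ => ((t.toMul : 𝓞 (K₁ d)) : K₁ d)) hx)
        have hw' : unitIncl d w = x.toMul := hw
        obtain ⟨n, hn⟩ := hε₀ w
        refine ⟨n, ?_⟩
        rcases hn with hn | hn
        · left
          rw [hn, map_zpow] at hw'
          exact congrArg Additive.ofMul hw'.symm
        · right
          rw [hn, ← mul_neg_one, map_mul, map_zpow, unitIncl_neg_one] at hw'
          exact congrArg Additive.ofMul hw'.symm
      τ_e := unitAct_unitIncl τ ε₀
      τ_t := unitAct_neg_one _
      g_e := hge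
      e_free := fun n hn => by
        have h1 : unitIncl d (ε₀ ^ n) = unitIncl d 1 := by
          rw [map_zpow, map_one]
          exact hn
        exact fundamentalUnit_zpow_ne_one hd hε₀ (unitIncl_injective h1) }

theorem neg_one_mem_range_unitNorm (hd : ¬ 3 ∣ d) : -1 ∈ (unitNorm d).range := by
  refine ⟨-1, units_ext ?_⟩
  change Algebra.norm (K₀ d) (-1 : K₁ d) = -1
  have h1 : (-1 : K₁ d) = algebraMap (K₀ d) (K₁ d) (-1) := by simp
  rw [h1, Algebra.norm_algebraMap, finrank_K₀_K₁ hd]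
  norm_num

theorem pow_three_mem_range_unitNorm (hd : ¬ 3 ∣ d) (u : (𝓞 (K₀ d))ˣ) :
    u ^ 3 ∈ (unitNorm d).range := by
  refine ⟨unitIncl d u, units_ext ?_⟩
  change Algebra.norm (K₀ d) (algebraMap (K₀ d) (K₁ d) ((u : 𝓞 (K₀ d)) : K₀ d)) = _
  rw [Algebra.norm_algebraMap, finrank_K₀_K₁ hd]
  rfl

theorem unitNorm_surjective (hd : ¬ 3 ∣ d) {ε₀ : (𝓞 (K₀ d))ˣ} (hε₀ : IsFundamentalUnit ε₀)
    (h : ε₀ ∈ (unitNorm d).range) : Function.Surjective (unitNorm d) := by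
  rw [← MonoidHom.range_eq_top, eq_top_iff]
  rintro u -
  obtain ⟨n, hn | hn⟩ := hε₀ u
  · rw [hn]
    exact zpow_mem h n
  · rw [hn, ← mul_neg_one]
    exact mul_mem (zpow_mem h n) (neg_one_mem_range_unitNorm hd)

theorem card_coker_unitNorm (hd : ¬ 3 ∣ d) {ε₀ : (𝓞 (K₀ d))ˣ} (hε₀ : IsFundamentalUnit ε₀)
    (h : ε₀ ∉ (unitNorm d).range) : Nat.card ((𝓞 (K₀ d))ˣ ⧸ (unitNorm d).range) = 3 := by
  set q : (𝓞 (K₀ d))ˣ ⧸ (unitNorm d).range := QuotientGroup.mk ε₀ with hq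
  have h1 : q ≠ 1 := by
    rw [hq, Ne, QuotientGroup.eq_one_iff]
    exact h
  have h3 : q ^ 3 = 1 := by
    rw [hq, ← QuotientGroup.mk_pow, QuotientGroup.eq_one_iff]
    exact pow_three_mem_range_unitNorm hd ε₀
  have htop : Subgroup.zpowers q = ⊤ := by
    rw [eq_top_iff]
    rintro x -
    obtain ⟨u, rfl⟩ := QuotientGroup.mk_surjective x
    obtain ⟨n, hn | hn⟩ := hε₀ u
    · exact ⟨n, by rw [hn, QuotientGroup.mk_zpow]⟩
    · refine ⟨n, ?_⟩
      change q ^ n = _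
      rw [hq, ← QuotientGroup.mk_zpow, QuotientGroup.eq, hn, ← mul_neg_one, inv_mul_cancel_left]
      exact neg_one_mem_range_unitNorm hd
  rw [← Subgroup.card_top, ← htop, Nat.card_zpowers]
  exact orderOf_eq_prime h3 h1

end KummerUnits

namespace KummerUnits

/-! ### Assembling the two cases. -/

variable {d : ℕ}

theorem mul_unitsAut_eq_one_iff {K : Type*} [Field K] (σ : K ≃+* K) (v : (𝓞 K)ˣ) :
    v * unitsAut (RingOfIntegers.mapRingEquiv σ) v = 1 ↔
      (unitAct σ).toAdditive (Additive.ofMul v) = -Additive.ofMul v := by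
  rw [mul_comm, ← eq_inv_iff_mul_eq_one]
  exact Iff.rfl

theorem mem_range_unitNorm_iff (hd : ¬ 3 ∣ d) {τ : K₁ d ≃ₐ[K₀ d] K₁ d}
    (hτ : Subgroup.zpowers τ = ⊤) {ε₀ : (𝓞 (K₀ d))ˣ} :
    ε₀ ∈ (unitNorm d).range ↔ ∃ η : Additive (𝓞 (K₁ d))ˣ,
      η + (unitAct τ.toRingEquiv).toAdditive η + (unitAct τ.toRingEquiv).toAdditive
        ((unitAct τ.toRingEquiv).toAdditive η) = Additive.ofMul (unitIncl d ε₀) := by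
  constructor
  · rintro ⟨u, hu⟩
    refine ⟨Additive.ofMul u, ?_⟩
    rw [← hu, unitIncl_unitNorm hd hτ]
    rfl
  · rintro ⟨η, hη⟩
    refine ⟨η.toMul, unitIncl_injective ?_⟩
    rw [unitIncl_unitNorm hd hτ]
    exact hη

theorem caseI_of_mem_range (hd : ¬ 3 ∣ d) {ε₀ : (𝓞 (K₀ d))ˣ} (hε₀ : IsFundamentalUnit ε₀)
    {g : K₁ d ≃ₐ[B₁ d] K₁ d} (hg : Subgroup.zpowers g = ⊤) {τ : K₁ d ≃ₐ[K₀ d] K₁ d}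
    (hτ : Subgroup.zpowers τ = ⊤) (h : ε₀ ∈ (unitNorm d).range) :
    CaseI d g.toRingEquiv τ.toRingEquiv ε₀ := by
  obtain ⟨hker, ⟨x, hNx, b, h0, h1, h2⟩, hL⟩ := (unitModule hd hε₀ hg hτ).case_norm
    (gb := actModCubes g.toRingEquiv) (τb := actModCubes τ.toRingEquiv) (fun _ => rfl)
    (fun _ => rfl) (finrank_M hd hg) ((mem_range_unitNorm_iff hd hτ).1 h)
  obtain ⟨σ, θ, hC⟩ := exists_cubicExtension hd hg hτ
  refine ⟨hker, hC.extendedHom_injective fun v hgv hNv => ?_, unitNorm_surjective hd hε₀ h,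
    x.toMul / unitAct τ.toRingEquiv x.toMul, x.toMul, ⟨b, h0, h1, h2⟩, rfl, hNx⟩
  obtain ⟨w, hw⟩ := hL (Additive.ofMul v) ((mul_unitsAut_eq_one_iff _ v).1 hgv) hNv
  exact mem_coboundaries.2 ⟨w.toMul, hw⟩

theorem caseII_of_notMem_range (hd : ¬ 3 ∣ d) {ε₀ : (𝓞 (K₀ d))ˣ} (hε₀ : IsFundamentalUnit ε₀)
    {g : K₁ d ≃ₐ[B₁ d] K₁ d} (hg : Subgroup.zpowers g = ⊤) {τ : K₁ d ≃ₐ[K₀ d] K₁ d}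
    (hτ : Subgroup.zpowers τ = ⊤) (h : ε₀ ∉ (unitNorm d).range) :
    CaseII d g.toRingEquiv τ.toRingEquiv ε₀ := by
  obtain ⟨hker, x, ⟨hgx, hNx, b, h0, h1, h2⟩, hx, hL⟩ := (unitModule hd hε₀ hg hτ).case_not_norm
    (gb := actModCubes g.toRingEquiv) (τb := actModCubes τ.toRingEquiv) (fun _ => rfl)
    (fun _ => rfl) (finrank_M hd hg) (fun h' => h ((mem_range_unitNorm_iff hd hτ).2 h'))
  obtain ⟨σ, θ, hC⟩ := exists_cubicExtension hd hg hτ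
  refine ⟨hker, hC.card_ker_extendedHom (l := x.toMul) ((mul_unitsAut_eq_one_iff _ x.toMul).2 hgx)
    hNx ?_ fun v hgv hNv => ?_, card_coker_unitNorm hd hε₀ h,
    x.toMul / unitAct τ.toRingEquiv x.toMul, x.toMul, ⟨b, h0, h1, h2⟩, rfl, hNx⟩
  · intro hmem
    obtain ⟨w, hw⟩ := mem_coboundaries.1 hmem
    exact hx (Additive.ofMul w) hw
  · obtain ⟨k, w, hw⟩ := hL (Additive.ofMul v) ((mul_unitsAut_eq_one_iff _ v).1 hgv) hNv
    refine ⟨k, mem_coboundaries.2 ⟨w.toMul, ?_⟩⟩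
    rw [div_eq_iff_eq_mul, mul_comm]
    exact hw

end KummerUnits

theorem theorem1 (d : ℕ) (hd : ¬ 3 ∣ d)
    (ε₀ : (NumberField.RingOfIntegers (KummerUnits.K₀ d))ˣ)
    (hε₀ : KummerUnits.IsFundamentalUnit ε₀)
    (g : KummerUnits.K₁ d ≃ₐ[KummerUnits.B₁ d] KummerUnits.K₁ d)
    (hg : Subgroup.zpowers g = ⊤)
    (τ : KummerUnits.K₁ d ≃ₐ[KummerUnits.K₀ d] KummerUnits.K₁ d)
    (hτ : Subgroup.zpowers τ = ⊤) :
    Xor (KummerUnits.CaseI d g.toRingEquiv τ.toRingEquiv ε₀)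
      (KummerUnits.CaseII d g.toRingEquiv τ.toRingEquiv ε₀) := by
  -- The two cases exclude each other already through the dimension of `M[1-τ]`.
  by_cases h : ε₀ ∈ (KummerUnits.unitNorm d).range
  · refine Or.inl ⟨KummerUnits.caseI_of_mem_range hd hε₀ hg hτ h, fun h2 => ?_⟩
    have h1 := (KummerUnits.caseI_of_mem_range hd hε₀ hg hτ h).finrank_ker
    rw [h2.finrank_ker] at h1
    norm_num at h1
  · refine Or.inr ⟨KummerUnits.caseII_of_notMem_range hd hε₀ hg hτ h, fun h2 => ?_⟩
    have h1 := (KummerUnits.caseII_of_notMem_range hd hε₀ hg hτ h).finrank_ker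
    rw [h2.finrank_ker] at h1
    norm_num at h1
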